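/- **Theorem 3.5.** Let $d\ge 1$ and let $|\cdot|$ be the $1$-norm on $\mathbb{Z}^d$. Let $m_x$, $k_x$ ($x\in\mathbb{Z}^d$) and $\lambda_{x,y}=\lambda_{y,x}$ ($|x-y|=1$) be real random variables on a probability space $(\Omega,\mathbb{P})$, and let $m_{\min},m_{\max},k_{\max},\lambda_{\max}$ be deterministic constants with $m_{\min}>0$ such that, almost surely, $m_{\min}\le m_x\le m_{\max}$ and $0\le k_x\le k_{\max}$ for all $x$, and $0\le\lambda_{x,y}\le\lambda_{\max}$ for all $|x-y|=1$. For an integer $L\ge 1$ let $\Lambda_L=[-L,L]^d\cap\mathbb{Z}^d$, and let $H_L$ be the self-adjoint closure in $L^2(\mathbb{R}^{\Lambda_L})$ of $$\sum_{x\in\Lambda_L}\Big(\frac{1}{2m_x}p_x^2+\frac{k_x}{2}q_x^2\Big)+\sum_{\{x,y\}\subset\Lambda_L,\ |x-y|=1}\lambda_{x,y}(q_x-q_y)^2$$ on the Schwartz space, where $q_x$ is multiplication by the coordinate $q_x$ and $p_x=-i\,\partial/\partial q_x$ (self-adjoint operators). Let $\tau_t(A)=e^{itH_L}Ae^{-itH_L}$.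 Let $h_{0,L}$ be the symmetric matrix indexed by $\Lambda_L$ with diagonal entries $\frac{k_x}{2}+\sum_{u\in\Lambda_L,|u-x|=1}\lambda_{x,u}$, entries $-\lambda_{x,y}$ for $|x-y|=1$, and $0$ otherwise; assume that almost surely $h_{0,L}$ is positive definite for all $L\ge1$. Put $h_L=\mu^{1/2}h_{0,L}\mu^{1/2}$ with the diagonal matrix $\mu=\mathrm{diag}(1/(2m_x))$. For $\alpha\in\mathbb{R}$ and $r>0$ say that $h_L$ has exponentially decaying $(\alpha,r)$-eigenfunction correlators if there are $C<\infty$ and $\eta>0$ such that $$\mathbb{E}\Big(\sup_{u:\mathbb{R}\to\mathbb{C},\ |u|\le 1}\big|\langle\delta_x,h_L^{\alpha}u(h_L)\delta_y\rangle\big|^r\Big)\le Ce^{-\eta|x-y|}\quad\text{for all } L\ge 1 \text{ and } x,y\in\Lambda_L .$$ Products and commutators of unbounded operators are taken on their natural domains ($D([A,B])=D(AB)\cap D(BA)$), and the norm of a densely defined operator $T$ is $\|T\|=\sup\{\|T\psi\|:\psi\in D(T),\|\psi\|\le1\}$; the commutators below are almost surely densely defined. Then: (a) If, for some $r\in(0,1]$,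 $h_L$ has exponentially decaying $(-1/2,r)$-eigenfunction correlators, then there exist $C'<\infty$ and $\mu'>0$ such that $$\mathbb{E}\Big(\sup_{t\in\mathbb{R}}\big\|[\tau_t(q_x),q_y]\big\|^r\Big)\le C'e^{-\mu'|x-y|}\quad\text{for all } L\ge 1 \text{ and } x,y\in\Lambda_L .$$ (b) If $h_L$ has exponentially decaying $(0,1)$-eigenfunction correlators, then there exist $C'<\infty$ and $\mu'>0$ such that $$\mathbb{E}\Big(\sup_{t\in\mathbb{R}}\max\big\{\|[\tau_t(p_x),q_y]\|,\ \|[\tau_t(q_x),p_y]\|,\ \|[\tau_t(p_x),p_y]\|\big\}\Big)\le C'e^{-\mu'|x-y|}\quad\text{for all } L\ge 1 \text{ and } x,y\in\Lambda_L .$$ -/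

import Mathlib

open MeasureTheory SchwartzMap
open scoped ENNReal LineDeriv

noncomputable section

/-! ## Unbounded operators on a complex Hilbert space -/

section Unbounded

variable {H : Type*} [NormedAddCommGroup H] [InnerProductSpace ℂ H]

/-- The product `A B` of two unbounded operators on its natural domain
`{ψ ∈ D(B) : B ψ ∈ D(A)}`. -/
def pmapMul (A B : H →ₗ.[ℂ] H) : H →ₗ.[ℂ] H where
  domain := (A.domain.comap B.toFun).map B.domain.subtype
  toFun :=
    have hB : ∀ ψ : (A.domain.comap B.toFun).map B.domain.subtype, (ψ : H) ∈ B.domain := fun ψ => by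
      obtain ⟨φ, -, h⟩ := ψ.2
      exact h ▸ φ.2
    have hA : ∀ ψ : (A.domain.comap B.toFun).map B.domain.subtype,
        B ⟨ψ, hB ψ⟩ ∈ A.domain := fun ψ => by
      obtain ⟨ψ, φ, hφ, h⟩ := ψ
      subst h
      exact hφ
    { toFun := fun ψ => A ⟨B ⟨ψ, hB ψ⟩, hA ψ⟩
      map_add' := fun ψ φ => by
        rw [← LinearPMap.map_add]
        exact congrArg A (Subtype.ext (LinearPMap.map_add B ⟨ψ, hB ψ⟩ ⟨φ, hB φ⟩))
      map_smul' := fun c ψ => by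
        rw [RingHom.id_apply, ← LinearPMap.map_smul]
        exact congrArg A (Subtype.ext (LinearPMap.map_smul B c ⟨ψ, hB ψ⟩)) }

/-- The commutator `[A, B] = A B - B A` on its natural domain `D(AB) ∩ D(BA)`. -/
def pmapComm (A B : H →ₗ.[ℂ] H) : H →ₗ.[ℂ] H := pmapMul A B - pmapMul B A

open Classical in
/-- The norm of a densely defined operator, `sup {‖T ψ‖ : ψ ∈ D(T), ‖ψ‖ ≤ 1}`, which is the norm
of its bounded extension to the whole space and is `∞` if there is none. An operator
that is not densely defined is given the norm `∞`. -/
def opENorm (T : H →ₗ.[ℂ] H) : ℝ≥0∞ :=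
  if Dense (T.domain : Set H) then ⨆ ψ : T.domain, ⨆ _ : ‖(ψ : H)‖ ≤ 1, ‖T ψ‖ₑ else ∞

/-- `U` is a strongly continuous one-parameter unitary group whose generator is `T`, that is,
`U t = exp (-i t T)` in the sense of Stone's theorem: `ψ ∈ D(T)` and `T ψ = φ` if and only if
`t ↦ U t ψ` is differentiable at `0` with derivative `-i φ`. -/
structure IsUnitaryGroupOf (T : H →ₗ.[ℂ] H) (U : ℝ → H ≃ₗᵢ[ℂ] H) : Prop where
  map_add : ∀ s t, U (s + t) = U s * U t
  continuous : ∀ ψ, Continuous fun t => U t ψ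
  generator : ∀ ψ φ, (ψ, φ) ∈ T.graph ↔ HasDerivAt (fun t => U t ψ) (-(Complex.I • φ)) 0

open Classical in
/-- `expGroup T t = exp (-i t T)`, the unitary group generated by `T`. By Stone's theorem it exists
and is unique for self-adjoint `T`; the value for a `T` that generates no unitary group is
irrelevant. -/
def expGroup (T : H →ₗ.[ℂ] H) : ℝ → H ≃ₗᵢ[ℂ] H :=
  if h : ∃ U, IsUnitaryGroupOf T U then h.choose else fun _ => 1

/-- The Heisenberg evolution `τ_t(A) = exp (i t T) A exp (-i t T)` of an unbounded operator `A`, on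
its natural domain `{ψ : exp (-i t T) ψ ∈ D(A)}`. -/
def heisenberg (T : H →ₗ.[ℂ] H) (t : ℝ) (A : H →ₗ.[ℂ] H) : H →ₗ.[ℂ] H :=
  pmapMul ((expGroup T (-t)).toLinearEquiv.toLinearMap.toPMap ⊤)
    (pmapMul A ((expGroup T t).toLinearEquiv.toLinearMap.toPMap ⊤))

end Unbounded

/-! ## Operators on `L²(ℝ^ι)` given on the Schwartz space -/

section Schwartz

variable (ι : Type*) [Fintype ι]

/-- The Hilbert space `L²(ℝ^ι)`. -/
abbrev L2 : Type _ := Lp ℂ 2 (volume : Measure (EuclideanSpace ℝ ι))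

/-- The Schwartz space of `ℝ^ι`. -/
abbrev Schw : Type _ := 𝓢(EuclideanSpace ℝ ι, ℂ)

/-- The embedding of the Schwartz space into `L²(ℝ^ι)`. -/
def schwToL2 : Schw ι →ₗ[ℂ] L2 ι := (toLpCLM ℂ ℂ 2 volume).toLinearMap

theorem schwToL2_injective : Function.Injective (schwToL2 ι) :=
  injective_toLp 2 volume

variable {ι}

/-- An operator on the Schwartz space as an unbounded operator on `L²(ℝ^ι)`. -/
def coreOp (A : Module.End ℂ (Schw ι)) : L2 ι →ₗ.[ℂ] L2 ι where
  domain := LinearMap.range (schwToL2 ι)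
  toFun := schwToL2 ι ∘ₗ A ∘ₗ
    (LinearEquiv.ofInjective (schwToL2 ι) (schwToL2_injective ι)).symm.toLinearMap

/-- The closure in `L²(ℝ^ι)` of an operator on the Schwartz space. -/
def closedOp (A : Module.End ℂ (Schw ι)) : L2 ι →ₗ.[ℂ] L2 ι := (coreOp A).closure

/-- Multiplication by the coordinate `q_x` on the Schwartz space. -/
def posS (x : ι) : Module.End ℂ (Schw ι) :=
  (smulLeftCLM ℂ (fun q : EuclideanSpace ℝ ι => ((q x : ℝ) : ℂ))).toLinearMap

theorem posS_apply (x : ι) (f : Schw ι) (q : EuclideanSpace ℝ ι) :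
    posS x f q = (q x : ℂ) * f q := by
  have h : Function.HasTemperateGrowth (fun q : EuclideanSpace ℝ ι => ((q x : ℝ) : ℂ)) :=
    (Complex.ofRealCLM.comp (EuclideanSpace.proj x : EuclideanSpace ℝ ι →L[ℝ] ℝ)).hasTemperateGrowth
  exact smulLeftCLM_apply_apply h f q

open Classical in
/-- `-i ∂/∂q_x` on the Schwartz space. -/
def momS (x : ι) : Module.End ℂ (Schw ι) :=
  (-Complex.I) •
    (LineDeriv.lineDerivOpCLM ℂ (Schw ι) (EuclideanSpace.single x (1 : ℝ))).toLinearMap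

/-- The self-adjoint position operator `q_x` on `L²(ℝ^ι)`. -/
def posOp (x : ι) : L2 ι →ₗ.[ℂ] L2 ι := closedOp (posS x)

/-- The self-adjoint momentum operator `p_x` on `L²(ℝ^ι)`. -/
def momOp (x : ι) : L2 ι →ₗ.[ℂ] L2 ι := closedOp (momS x)

end Schwartz

/-! ## Functional calculus of real symmetric matrices -/

/-- `φ(A) = O φ(D) Oᵀ` for a real symmetric matrix `A = O D Oᵀ`, with `O` orthogonal and `D`
diagonal, and an arbitrary `φ : ℝ → ℂ`. -/
def matFun {n : Type*} [Fintype n] [DecidableEq n] {A : Matrix n n ℝ} (hA : A.IsHermitian)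
    (φ : ℝ → ℂ) : Matrix n n ℂ :=
  (hA.eigenvectorUnitary : Matrix n n ℝ).map Complex.ofReal *
    Matrix.diagonal (fun j => φ (hA.eigenvalues j)) *
    ((hA.eigenvectorUnitary : Matrix n n ℝ).transpose).map Complex.ofReal

/-! ## The oscillator system -/

/-- The `1`-norm distance `|x - y|` on `ℤ^d`. -/
def dist1 {d : ℕ} (x y : Fin d → ℤ) : ℤ := ∑ i, |x i - y i|

/-- The cube `Λ_L = [-L, L]^d ∩ ℤ^d`. -/
def box (d L : ℕ) : Finset (Fin d → ℤ) :=
  Finset.Icc (fun _ => -(L : ℤ)) (fun _ => (L : ℤ))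

/-- Masses, spring constants and couplings; a coupling is attached to an unordered pair of sites, and
only the pairs at distance one matter. -/
structure OscParams (d : ℕ) where
  m : (Fin d → ℤ) → ℝ
  k : (Fin d → ℤ) → ℝ
  lam : Sym2 (Fin d → ℤ) → ℝ

namespace OscParams

variable {d : ℕ} (p : OscParams d)

/-- The bounds on the parameters. -/
structure Bounded (mmin mmax kmax lammax : ℝ) : Prop where
  m_mem : ∀ x, p.m x ∈ Set.Icc mmin mmax
  k_mem : ∀ x, p.k x ∈ Set.Icc 0 kmax
  lam_mem : ∀ x y, dist1 x y = 1 → p.lam s(x, y) ∈ Set.Icc 0 lammax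

/-- The many-body Hamiltonian
`∑_x (p_x² / (2 m_x) + (k_x / 2) q_x²) + ∑_{{x,y}, |x-y|=1} λ_{x,y} (q_x - q_y)²`
on the Schwartz space; the sum over undirected edges is half of the sum over ordered pairs. -/
def hamS (L : ℕ) : Module.End ℂ (Schw (box d L)) :=
  ∑ x : box d L, (((1 / (2 * p.m x) : ℝ) : ℂ) • momS x ^ 2 + ((p.k x / 2 : ℝ) : ℂ) • posS x ^ 2) +
    (1 / 2 : ℂ) • ∑ x : box d L, ∑ y : box d L,
      if dist1 (x : Fin d → ℤ) y = 1 then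
        ((p.lam s((x : Fin d → ℤ), y) : ℝ) : ℂ) • (posS x - posS y) ^ 2
      else 0

/-- The self-adjoint Hamiltonian `H_L` on `L²(ℝ^{Λ_L})`. -/
def ham (L : ℕ) : L2 (box d L) →ₗ.[ℂ] L2 (box d L) := closedOp (p.hamS L)

/-- The matrix `h_{0,L}`. -/
def h0 (L : ℕ) : Matrix (box d L) (box d L) ℝ := fun x y =>
  if x = y then
    p.k x / 2 + ∑ u : box d L,
      if dist1 (u : Fin d → ℤ) x = 1 then p.lam s((x : Fin d → ℤ), u) else 0
  else if dist1 (x : Fin d → ℤ) y = 1 then -p.lam s((x : Fin d → ℤ), y)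
  else 0

/-- The diagonal matrix `μ^{1/2}`, where `μ_{x,x} = 1 / (2 m_x)`. -/
def sqrtMu (L : ℕ) : Matrix (box d L) (box d L) ℝ :=
  Matrix.diagonal fun x => Real.sqrt (1 / (2 * p.m x))

/-- The one-particle Hamiltonian `h_L = μ^{1/2} h_{0,L} μ^{1/2}`. -/
def h (L : ℕ) : Matrix (box d L) (box d L) ℝ := p.sqrtMu L * p.h0 L * p.sqrtMu L

theorem h0_isHermitian (L : ℕ) : (p.h0 L).IsHermitian := by
  ext x y
  have hs : dist1 (y : Fin d → ℤ) x = dist1 (x : Fin d → ℤ) y := by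
    simp [dist1, abs_sub_comm]
  by_cases hxy : x = y
  · subst hxy; rfl
  · simp [h0, Matrix.conjTranspose_apply, hxy, Ne.symm hxy, hs, Sym2.eq_swap]

theorem h_isHermitian (L : ℕ) : (p.h L).IsHermitian := by
  have h1 : (p.sqrtMu L).conjTranspose = p.sqrtMu L := by simp [sqrtMu]
  have h2 := Matrix.isHermitian_mul_mul_conjTranspose (p.sqrtMu L) (p.h0_isHermitian L)
  rwa [h1] at h2

/-- `sup_{|u| ≤ 1} |⟨δ_x, h_L^α u(h_L) δ_y⟩|^r`, the supremum being over all functions `u : ℝ → ℂ`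
with `|u| ≤ 1`. -/
def correlator (α r : ℝ) (L : ℕ) (x y : box d L) : ℝ≥0∞ :=
  ⨆ u : ℝ → ℂ, ⨆ _ : ∀ s, ‖u s‖ ≤ 1,
    ‖matFun (p.h_isHermitian L) (fun s => ((s ^ α : ℝ) : ℂ) * u s) x y‖ₑ ^ r

/-- `‖[τ_t(A), B]‖` for the dynamics `τ_t` generated by `H_L`. -/
def commNorm (L : ℕ) (t : ℝ) (A B : L2 (box d L) →ₗ.[ℂ] L2 (box d L)) : ℝ≥0∞ :=
  opENorm (pmapComm (heisenberg (p.ham L) t A) B)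

end OscParams

/-- A family `F ω L x y` of random quantities is exponentially decaying in mean, with constants
`C < ∞`, `μ > 0` independent of `L ≥ 1` and of `x, y ∈ Λ_L`. -/
def ExpDecayInMean {Ω : Type*} [MeasurableSpace Ω] (P : Measure Ω) {d : ℕ}
    (F : Ω → (L : ℕ) → box d L → box d L → ℝ≥0∞) : Prop :=
  ∃ C μ : ℝ, 0 < μ ∧ ∀ L : ℕ, 1 ≤ L → ∀ x y : box d L,
    ∫⁻ ω, F ω L x y ∂P ≤ ENNReal.ofReal (C * Real.exp (-μ * dist1 (x : Fin d → ℤ) y))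

end

/-! The Hamiltonian is quadratic, so its dynamics is that of independent normal modes, and
commutators of evolved positions and momenta are multiples of the identity. Put `s_x = (2
m_x)^{-1/2}` and diagonalize `h_L = O diag(ω_j²) Oᵀ`; positivity of `h_{0,L}` gives `ω_j > 0`. With
`Q_j = ∑ O_{xj} q_x / s_x`, `P_j = ∑ O_{xj} s_x p_x` and `a_j = ω_j Q_j + i P_j` one has `[a_j,
a_k†] = 2 ω_j δ_{jk}` and `H_L = ∑ (P_j² + ω_j² Q_j²) = ∑ (a_j† a_j + ω_j)`. Hence `a_j` evolves by
the phase `exp(-2iω_j t)`. Up to a unimodular factor, `[τ_t(q_x), q_y]` is `s_x s_y ⟨δ_x, h^{-1/2}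
sin(2t h^{1/2}) δ_y⟩`, the mixed commutators are quotients of `s_x`, `s_y` times `⟨δ_x, cos(2t
h^{1/2}) δ_y⟩`, and `[τ_t(p_x), p_y]` is `(s_x s_y)⁻¹ ⟨δ_x, h^{1/2} sin(2t h^{1/2}) δ_y⟩`. Sine and
cosine are admissible functions `u` in the correlator for every `t`, the masses are bounded, and the
factor `h^{1/2}` costs only a constant, because the spectrum of `h_L` is bounded uniformly in `L`.
The correlators thus dominate the commutators for almost every realization, and taking expectations
finishes the proof.

The analytic work is to justify this for unbounded operators. The Fock vectors, obtained from a
Gaussian vacuum by creation operators, are Schwartz eigenfunctions of `H_L` and form a complete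
orthogonal system (`NormalModes.exists_hilbertBasis`). So the closure generates a unitary group
(`FormalAdj.exists_isUnitaryGroupOf`), whose action on the span of the Fock vectors is explicit
(`NormalModes.modeOp_evolved`). The commutator on its full natural domain is then identified by
testing against that span (`NormalModes.opENorm_pmapComm_heisenberg_le`). -/

/-! ## Operators on the Schwartz space -/

section SchwartzOperators

variable {ι : Type*} [Fintype ι]

/-- The operators `A` and `B` on the Schwartz space are formally adjoint to each other with respect
to the `L²` inner product. -/
def FormalAdj (A B : Module.End ℂ (Schw ι)) : Prop :=
  ∀ f g, inner ℂ (schwToL2 ι (A f)) (schwToL2 ι g) = inner ℂ (schwToL2 ι f) (schwToL2 ι (B g))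

theorem FormalAdj.symm {A B : Module.End ℂ (Schw ι)} (h : FormalAdj A B) : FormalAdj B A :=
  fun f g => by
    rw [← inner_conj_symm, ← h g f, inner_conj_symm]

theorem FormalAdj.add {A B A' B' : Module.End ℂ (Schw ι)} (h : FormalAdj A B)
    (h' : FormalAdj A' B') : FormalAdj (A + A') (B + B') := fun f g => by
  simp only [LinearMap.add_apply, map_add, inner_add_left, inner_add_right, h f g, h' f g]

theorem FormalAdj.smul {A B : Module.End ℂ (Schw ι)} (h : FormalAdj A B) (c : ℂ) :
    FormalAdj (c • A) ((starRingEnd ℂ) c • B) := fun f g => by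
  simp only [LinearMap.smul_apply, map_smul, inner_smul_left, inner_smul_right, h f g]

theorem FormalAdj.mul {A B A' B' : Module.End ℂ (Schw ι)} (h : FormalAdj A B)
    (h' : FormalAdj A' B') : FormalAdj (A * A') (B' * B) := fun f g => by
  simp only [Module.End.mul_apply, h _ g, h' f]

theorem FormalAdj.one : FormalAdj (1 : Module.End ℂ (Schw ι)) 1 := fun _ _ => rfl

theorem FormalAdj.sum {κ : Type*} (s : Finset κ) {A B : κ → Module.End ℂ (Schw ι)}
    (h : ∀ i ∈ s, FormalAdj (A i) (B i)) : FormalAdj (∑ i ∈ s, A i) (∑ i ∈ s, B i) := fun f g => by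
  simp only [LinearMap.sum_apply, map_sum, sum_inner, inner_sum]
  exact Finset.sum_congr rfl fun i hi => h i hi f g

theorem inner_schwToL2 (f g : Schw ι) :
    inner ℂ (schwToL2 ι f) (schwToL2 ι g) = ∫ q, inner ℂ (f q) (g q) :=
  inner_toL2_toL2_eq f g

theorem formalAdj_posS (x : ι) : FormalAdj (posS x) (posS x) := fun f g => by
  rw [inner_schwToL2, inner_schwToL2]
  congr 1 with q
  simp only [posS_apply, RCLike.inner_apply, map_mul, Complex.conj_ofReal]
  ring

theorem momS_apply [DecidableEq ι] (x : ι) (f : Schw ι) (q : EuclideanSpace ℝ ι) :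
    momS x f q = -Complex.I * fderiv ℝ f q (EuclideanSpace.single x (1 : ℝ)) := by
  rw [momS, LinearMap.smul_apply, smul_apply, smul_eq_mul]
  congr 1
  rw [ContinuousLinearMap.coe_coe, LineDeriv.lineDerivOpCLM_apply, lineDerivOp_apply_eq_fderiv]
  congr!

theorem formalAdj_momS (x : ι) : FormalAdj (momS x) (momS x) := fun f g => by
  classical
  rw [inner_schwToL2, inner_schwToL2]
  have key := integral_bilinear_lineDerivOp_right_eq_neg_left (μ := volume) f g
    ((ContinuousLinearMap.mul ℝ ℂ).comp (Complex.conjCLE : ℂ →L[ℝ] ℂ))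
    (EuclideanSpace.single x (1 : ℝ))
  have h1 : ∀ q, inner ℂ (f q) (momS x g q) = -Complex.I *
      inner ℂ (f q) (∂_{EuclideanSpace.single x (1 : ℝ)} g q) := fun q => by
    rw [momS_apply, lineDerivOp_apply_eq_fderiv]
    simp only [RCLike.inner_apply]; ring
  have h2 : ∀ q, inner ℂ (momS x f q) (g q) = Complex.I *
      inner ℂ (∂_{EuclideanSpace.single x (1 : ℝ)} f q) (g q) := fun q => by
    rw [momS_apply, lineDerivOp_apply_eq_fderiv]
    simp only [RCLike.inner_apply, map_mul, map_neg, Complex.conj_I]; ring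
  simp only [h1, h2, integral_const_mul]
  have key' : ∫ q, inner ℂ (f q) (∂_{EuclideanSpace.single x (1 : ℝ)} g q) =
    -∫ q, inner ℂ (∂_{EuclideanSpace.single x (1 : ℝ)} f q) (g q) := by
    simpa [RCLike.inner_apply, mul_comm] using key
  rw [key']; ring

/-! ### Closures of symmetric operators -/

theorem dense_range_schwToL2 : Dense (LinearMap.range (schwToL2 ι) : Set (L2 ι)) :=
  denseRange_toLpCLM (p := 2) (by simp)

theorem mem_graph_coreOp (A : Module.End ℂ (Schw ι)) (f : Schw ι) :
    (schwToL2 ι f, schwToL2 ι (A f)) ∈ (coreOp A).graph := by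
  rw [LinearPMap.mem_graph_iff]
  refine ⟨⟨schwToL2 ι f, LinearMap.mem_range_self _ f⟩, rfl, ?_⟩
  change schwToL2 ι (A ((LinearEquiv.ofInjective (schwToL2 ι) (schwToL2_injective ι)).symm
    (LinearEquiv.ofInjective (schwToL2 ι) (schwToL2_injective ι) f))) = _
  rw [LinearEquiv.symm_apply_apply]

theorem mem_graph_coreOp_iff (A : Module.End ℂ (Schw ι)) (z : L2 ι × L2 ι) :
    z ∈ (coreOp A).graph ↔ ∃ f, z = (schwToL2 ι f, schwToL2 ι (A f)) := by
  constructor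
  · intro h
    have h' := h
    rw [LinearPMap.mem_graph_iff] at h'
    obtain ⟨⟨_, f, rfl⟩, h1, h2⟩ := h'
    refine ⟨f, Prod.ext h1.symm ?_⟩
    exact (coreOp A).mem_graph_snd_inj' h (mem_graph_coreOp A f) h1.symm
  · rintro ⟨f, rfl⟩
    exact mem_graph_coreOp A f

variable {A : Module.End ℂ (Schw ι)}

/-- A formal adjoint on a dense domain places `coreOp A` below the adjoint of `coreOp B`, and
adjoints are closed. -/
theorem FormalAdj.isClosable {B : Module.End ℂ (Schw ι)} (h : FormalAdj A B) :
    (coreOp A).IsClosable := by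
  have hd : Dense ((coreOp B).domain : Set (L2 ι)) := dense_range_schwToL2
  have hfa : (coreOp B).IsFormalAdjoint (coreOp A) := by
    intro ψ φ
    obtain ⟨f, hf⟩ : ∃ f, schwToL2 ι f = ψ := ψ.2
    obtain ⟨g, hg⟩ : ∃ g, schwToL2 ι g = φ := φ.2
    rw [(coreOp B).mem_graph_snd_inj ((coreOp B).mem_graph ψ) (mem_graph_coreOp B f) hf.symm,
      (coreOp A).mem_graph_snd_inj ((coreOp A).mem_graph φ) (mem_graph_coreOp A g) hg.symm,
      ← hf, ← hg]
    exact h.symm f g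
  exact ((LinearPMap.adjoint_isClosed hd).isClosable).leIsClosable (hfa.le_adjoint hd)

/-- Closability matters: `LinearPMap.closure` leaves a non-closable operator unchanged. -/
theorem FormalAdj.mem_graph_closedOp_iff {B : Module.End ℂ (Schw ι)} (h : FormalAdj A B)
    (z : L2 ι × L2 ι) :
    z ∈ (closedOp A).graph ↔
      z ∈ _root_.closure (Set.range fun f => (schwToL2 ι f, schwToL2 ι (A f))) := by
  rw [closedOp, ← h.isClosable.graph_closure_eq_closure_graph, ← SetLike.mem_coe,
    Submodule.topologicalClosure_coe]
  have : ((coreOp A).graph : Set (L2 ι × L2 ι)) =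
      Set.range fun f => (schwToL2 ι f, schwToL2 ι (A f)) := by
    ext z
    rw [SetLike.mem_coe, mem_graph_coreOp_iff]
    exact ⟨fun ⟨f, hf⟩ => ⟨f, hf.symm⟩, fun ⟨f, hf⟩ => ⟨f, hf.symm⟩⟩
  rw [this]

theorem mem_graph_closedOp (A : Module.End ℂ (Schw ι)) (f : Schw ι) :
    (schwToL2 ι f, schwToL2 ι (A f)) ∈ (closedOp A).graph :=
  LinearPMap.le_graph_of_le (LinearPMap.le_closure _) (mem_graph_coreOp A f)

/-- The identity is a closed condition on the pair `(ψ, φ)` and holds on the core. It lets closed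
operators be handled weakly, by moving them onto Schwartz functions. -/
theorem FormalAdj.inner_of_mem_graph {B : Module.End ℂ (Schw ι)} (h : FormalAdj A B)
    {ψ φ : L2 ι} (hz : (ψ, φ) ∈ (closedOp A).graph) (f : Schw ι) :
    inner ℂ (schwToL2 ι f) φ = inner ℂ (schwToL2 ι (B f)) ψ := by
  rw [h.mem_graph_closedOp_iff] at hz
  have hc : IsClosed {z : L2 ι × L2 ι |
      inner ℂ (schwToL2 ι f) z.2 = inner ℂ (schwToL2 ι (B f)) z.1} :=
    isClosed_eq (by fun_prop) (by fun_prop)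
  refine closure_minimal ?_ hc hz
  rintro _ ⟨g, rfl⟩
  exact (h.symm f g).symm

end SchwartzOperators

/-! ## Unitary groups that are diagonal in a Hilbert basis -/

section DiagonalGroup

open Filter Topology

variable {H κ : Type*} [NormedAddCommGroup H] [InnerProductSpace ℂ H] (b : HilbertBasis κ ℂ H)

theorem HilbertBasis.hasSum_norm_sq_repr (v : H) :
    HasSum (fun i => ‖b.repr v i‖ ^ 2) (‖v‖ ^ 2) := by
  have h := lp.hasSum_norm (p := 2) (by simp) (b.repr v)
  simpa [LinearIsometryEquiv.norm_map] using h

/-- Parseval turns the squared norm into a series of coordinates, to which dominated convergence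
applies. -/
theorem HilbertBasis.tendsto_zero_of_dominated {α : Type*} {l : Filter α} {v : α → H}
    {bound : κ → ℝ} (hs : Summable bound) (hb : ∀ᶠ a in l, ∀ i, ‖b.repr (v a) i‖ ^ 2 ≤ bound i)
    (hv : ∀ i, Tendsto (fun a => b.repr (v a) i) l (𝓝 0)) : Tendsto v l (𝓝 0) := by
  have h2 : Tendsto (fun a => ‖v a‖ ^ 2) l (𝓝 0) := by
    have h := tendsto_tsum_of_dominated_convergence (𝓕 := l)
      (f := fun a i => ‖b.repr (v a) i‖ ^ 2) (g := fun _ => (0 : ℝ)) hs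
      (fun i => by simpa using (hv i).norm.pow 2) (hb.mono fun a ha i => by simpa using ha i)
    simpa [(b.hasSum_norm_sq_repr _).tsum_eq] using h
  rw [tendsto_zero_iff_norm_tendsto_zero]
  simpa using (Real.continuous_sqrt.tendsto 0).comp h2 |>.congr fun a => by simp

/-- The unitary operator that multiplies the `i`-th coordinate by the phase `c i`. -/
theorem HilbertBasis.exists_diagonal [CompleteSpace H] (c : κ → ℂ) (hc : ∀ i, ‖c i‖ = 1) :
    ∃ U : H ≃ₗᵢ[ℂ] H, ∀ v i, b.repr (U v) i = c i * b.repr v i := by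
  have hcc : ∀ i, c i * (starRingEnd ℂ) (c i) = 1 := fun i => by
    rw [Complex.mul_conj, Complex.normSq_eq_norm_sq, hc]; simp
  have hon : Orthonormal ℂ fun i => c i • b i := by
    refine ⟨fun i => by rw [norm_smul, hc, b.orthonormal.1 i, one_mul], fun i j hij => ?_⟩
    simp only [inner_smul_left, inner_smul_right, b.orthonormal.2 hij, mul_zero]
  have hsp : ⊤ ≤ (Submodule.span ℂ (Set.range fun i => c i • b i)).topologicalClosure := by
    rw [← b.dense_span]
    refine Submodule.topologicalClosure_mono (Submodule.span_le.2 ?_)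
    rintro _ ⟨i, rfl⟩
    have : b i = (starRingEnd ℂ) (c i) • (c i • b i) := by
      rw [smul_smul, mul_comm, hcc, one_smul]
    rw [SetLike.mem_coe, this]
    exact Submodule.smul_mem _ _ (Submodule.subset_span ⟨i, rfl⟩)
  let b' := HilbertBasis.mk hon hsp
  refine ⟨b.repr.trans b'.repr.symm, fun v i => ?_⟩
  -- Pairing with `c i • b i` puts a conjugate phase on the `i`-th coordinate; multiplying by `c i`
  -- removes it.
  have h1 : b'.repr (b'.repr.symm (b.repr v)) i = b.repr v i := by
    rw [LinearIsometryEquiv.apply_symm_apply]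
  rw [b'.repr_apply_apply, show b' i = c i • b i from congrFun (HilbertBasis.coe_mk hon hsp) i,
    inner_smul_left] at h1
  rw [b.repr_apply_apply, LinearIsometryEquiv.trans_apply, ← h1, ← mul_assoc, hcc, one_mul]

theorem norm_exp_neg_I_mul_sub_one_le (t E : ℝ) :
    ‖Complex.exp (-(Complex.I * (t * E))) - 1‖ ≤ |t * E| := by
  have h := Real.norm_exp_I_mul_ofReal_sub_one_le (x := -(t * E))
  rw [Real.norm_eq_abs, abs_neg] at h
  refine le_trans (le_of_eq ?_) h
  push_cast
  rw [mul_neg]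

/-- The domain condition `∑ |E_i ψ_i|² < ∞` is encoded in the existence of a vector `φ` with
coordinates `E_i ψ_i`. That same `φ` supplies the summable majorant for the difference quotients. -/
theorem HilbertBasis.exists_diagonalGroup [CompleteSpace H] (E : κ → ℝ) :
    ∃ U : ℝ → H ≃ₗᵢ[ℂ] H, (∀ s t, U (s + t) = U s * U t) ∧ (∀ ψ, Continuous fun t => U t ψ) ∧
      ∀ ψ φ, HasDerivAt (fun t => U t ψ) (-(Complex.I • φ)) 0 ↔
        ∀ i, b.repr φ i = E i * b.repr ψ i := by
  have hn : ∀ (t : ℝ) i, ‖Complex.exp (-(Complex.I * (t * E i)))‖ = 1 := fun t i => by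
    have := Complex.norm_exp_ofReal_mul_I (-(t * E i))
    rw [← this]; congr 2; push_cast; ring
  choose U hU using fun t : ℝ => b.exists_diagonal (fun i => Complex.exp (-(Complex.I * (t * E i))))
    (hn t)
  have hext : ∀ v w : H, (∀ i, b.repr v i = b.repr w i) → v = w := fun v w h =>
    b.repr.injective (lp.ext (funext h))
  have hadd : ∀ s t, U (s + t) = U s * U t := fun s t => by
    ext v
    refine hext _ _ fun i => ?_
    rw [LinearIsometryEquiv.coe_mul, Function.comp_apply, hU, hU, hU,
      show -(Complex.I * (((s + t : ℝ) : ℂ) * E i)) = -(Complex.I * (s * E i)) +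
        -(Complex.I * (t * E i)) by push_cast; ring, Complex.exp_add, mul_assoc]
  have hzero : ∀ v, U 0 v = v := fun v => hext _ _ fun i => by simp [hU]
  have hcomp : ∀ i, HasDerivAt (fun t : ℝ => Complex.exp (-(Complex.I * (t * E i))))
      (-(Complex.I * E i)) 0 := fun i => by
    have h1 : HasDerivAt (fun t : ℝ => -(Complex.I * ((t : ℂ) * E i))) (-(Complex.I * (1 * E i))) 0 :=
      ((Complex.ofRealCLM.hasDerivAt.mul_const _).const_mul _).neg
    simpa using h1.cexp
  refine ⟨U, hadd, fun ψ => ?_, fun ψ φ => ⟨fun h i => ?_, fun h => ?_⟩⟩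
  · refine continuous_iff_continuousAt.2 fun t => ?_
    rw [ContinuousAt, ← tendsto_sub_nhds_zero_iff]
    -- Two phases differ by at most 2, whence the 4.
    refine b.tendsto_zero_of_dominated (bound := fun i => 4 * ‖b.repr ψ i‖ ^ 2)
      ((b.hasSum_norm_sq_repr ψ).summable.mul_left 4) (Eventually.of_forall fun s i => ?_) fun i => ?_
    · rw [map_sub, lp.coeFn_sub, Pi.sub_apply, hU, hU, ← sub_mul, norm_mul, mul_pow]
      refine mul_le_mul_of_nonneg_right ?_ (by positivity)
      have := norm_sub_le (Complex.exp (-(Complex.I * (s * E i))))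
        (Complex.exp (-(Complex.I * (t * E i))))
      rw [hn, hn] at this
      nlinarith [norm_nonneg (Complex.exp (-(Complex.I * (s * E i))) -
        Complex.exp (-(Complex.I * (t * E i))))]
    · simp only [map_sub, lp.coeFn_sub, Pi.sub_apply, hU]
      have : Continuous fun s : ℝ => Complex.exp (-(Complex.I * (s * E i))) * b.repr ψ i -
        Complex.exp (-(Complex.I * (t * E i))) * b.repr ψ i := by fun_prop
      simpa using this.tendsto t
  · have h1 := (innerSL ℂ (b i)).restrictScalars ℝ |>.hasFDerivAt.comp_hasDerivAt (0 : ℝ) h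
    have h2 := (hcomp i).mul_const (b.repr ψ i)
    have h3 : (fun t : ℝ => Complex.exp (-(Complex.I * (t * E i))) * b.repr ψ i) =
        ⇑((innerSL ℂ (b i)).restrictScalars ℝ) ∘ fun t => U t ψ := by
      ext t
      rw [← hU, b.repr_apply_apply]
      rfl
    rw [h3] at h2
    have h4 := h1.unique h2
    simp only [ContinuousLinearMap.coe_restrictScalars', innerSL_apply_apply, inner_neg_right,
      inner_smul_right, neg_mul, neg_inj, mul_assoc] at h4
    rw [← b.repr_apply_apply] at h4
    exact mul_left_cancel₀ Complex.I_ne_zero h4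
  · rw [hasDerivAt_iff_tendsto_slope_zero, ← tendsto_sub_nhds_zero_iff]
    -- Since `|exp(-itE) - 1| ≤ |tE|`, the difference quotient and its limit each contribute at most
    -- `|φ_i|` in the `i`-th coordinate.
    refine b.tendsto_zero_of_dominated (bound := fun i => 4 * ‖b.repr φ i‖ ^ 2)
      ((b.hasSum_norm_sq_repr φ).summable.mul_left 4) ?_ fun i => ?_
    · filter_upwards [self_mem_nhdsWithin] with t ht i
      have ht : t ≠ 0 := ht
      have e1 : b.repr (t⁻¹ • (U (0 + t) ψ - U 0 ψ) - -(Complex.I • φ)) i =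
          (t⁻¹ : ℝ) • ((Complex.exp (-(Complex.I * (t * E i))) - 1) * b.repr ψ i) +
            Complex.I * b.repr φ i := by
        rw [zero_add, hzero, ← Complex.coe_smul, ← Complex.coe_smul]
        simp only [map_sub, map_neg, map_smul, lp.coeFn_sub, Pi.sub_apply, lp.coeFn_neg,
          Pi.neg_apply, lp.coeFn_smul, Pi.smul_apply, hU, smul_eq_mul]
        ring
      have e2 : ‖(t⁻¹ : ℝ) • ((Complex.exp (-(Complex.I * (t * E i))) - 1) * b.repr ψ i)‖ ≤
          ‖b.repr φ i‖ := by
        rw [h i, norm_smul, norm_mul, norm_mul, ← mul_assoc]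
        refine mul_le_mul_of_nonneg_right ?_ (norm_nonneg _)
        refine (mul_le_mul_of_nonneg_left (norm_exp_neg_I_mul_sub_one_le t (E i))
          (norm_nonneg _)).trans (le_of_eq ?_)
        rw [abs_mul, norm_inv, Real.norm_eq_abs, Complex.norm_real, Real.norm_eq_abs,
          inv_mul_cancel_left₀ (abs_ne_zero.2 ht)]
      have e3 : ‖b.repr (t⁻¹ • (U (0 + t) ψ - U 0 ψ) - -(Complex.I • φ)) i‖ ≤
          2 * ‖b.repr φ i‖ := by
        rw [e1]
        refine (norm_add_le _ _).trans ?_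
        rw [norm_mul, Complex.norm_I, one_mul]
        linarith
      nlinarith [norm_nonneg (b.repr (t⁻¹ • (U (0 + t) ψ - U 0 ψ) - -(Complex.I • φ)) i)]
    · have h1 := (hasDerivAt_iff_tendsto_slope_zero.1 ((hcomp i).mul_const (b.repr ψ i))).sub_const
        (-(Complex.I * E i) * b.repr ψ i)
      rw [sub_self] at h1
      refine h1.congr fun t => ?_
      rw [← Complex.coe_smul, ← Complex.coe_smul]
      simp only [map_sub, map_neg, map_smul, lp.coeFn_sub, Pi.sub_apply, lp.coeFn_neg,
        Pi.neg_apply, lp.coeFn_smul, Pi.smul_apply, hU, smul_eq_mul, h i]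
      ring

end DiagonalGroup

/-! ### Essential self-adjointness from an eigenbasis -/

section EigenbasisGroup

variable {ι κ : Type*} [Fintype ι] {A : Module.End ℂ (Schw ι)}

/-- A symmetric operator on the Schwartz space with a complete orthonormal system of eigenfunctions
is essentially self-adjoint: its closure generates a unitary group. -/
theorem FormalAdj.exists_isUnitaryGroupOf (hA : FormalAdj A A) (b : HilbertBasis κ ℂ (L2 ι))
    (e : κ → Schw ι) (hb : ∀ i, b i = schwToL2 ι (e i)) (E : κ → ℝ)
    (hE : ∀ i, A (e i) = (E i : ℂ) • e i) : ∃ U, IsUnitaryGroupOf (closedOp A) U := by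
  obtain ⟨U, h1, h2, h3⟩ := b.exists_diagonalGroup E
  refine ⟨U, h1, h2, fun ψ φ => ?_⟩
  rw [h3]
  constructor
  · intro h i
    rw [b.repr_apply_apply, b.repr_apply_apply, hb, hA.inner_of_mem_graph h, hE, map_smul,
      inner_smul_left, Complex.conj_ofReal]
  · intro h
    rw [hA.mem_graph_closedOp_iff]
    -- The partial sums of the expansion of `ψ` are Schwartz functions, and `A` maps them to the
    -- partial sums of `φ`, so the pair is a limit of points of the core graph.
    refine mem_closure_of_tendsto ((b.hasSum_repr ψ).prodMk_nhds (b.hasSum_repr φ))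
      (Filter.Eventually.of_forall fun s => ?_)
    refine ⟨∑ i ∈ s, b.repr ψ i • e i, ?_⟩
    simp only [map_sum, map_smul, hE, h, hb, smul_smul, mul_comm]

/-- The unitary group acts on an eigenfunction by a phase. -/
theorem IsUnitaryGroupOf.apply_eigenvector {H : Type*} [NormedAddCommGroup H]
    [InnerProductSpace ℂ H] {T : H →ₗ.[ℂ] H} {U : ℝ → H ≃ₗᵢ[ℂ] H} (hU : IsUnitaryGroupOf T U)
    {ψ : H} {E : ℝ} (h : (ψ, (E : ℂ) • ψ) ∈ T.graph) (t : ℝ) :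
    U t ψ = Complex.exp (-(Complex.I * (t * E))) • ψ := by
  have h0 : U 0 = 1 := by
    have := hU.map_add 0 0
    rw [add_zero] at this
    exact (mul_eq_left.1 this.symm)
  -- The group law transports the derivative at `0` to every time.
  have hd : ∀ t, HasDerivAt (fun t => U t ψ) (-(Complex.I • ((E : ℂ) • U t ψ))) t := fun t => by
    have h1 := (hU.generator _ _).1 h
    have h2 := ((U t).toContinuousLinearEquiv : H →L[ℂ] H).restrictScalars ℝ
      |>.hasFDerivAt.comp_hasDerivAt (0 : ℝ) h1
    have h3 : HasDerivAt (fun s => U (t + s) ψ) (-(Complex.I • ((E : ℂ) • U t ψ))) 0 := by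
      convert h2 using 1
      · ext s
        simp [hU.map_add]
      · change _ = U t (-(Complex.I • ((E : ℂ) • ψ)))
        rw [map_neg, map_smul, map_smul]
    have h4 := HasDerivAt.comp_sub_const (f := fun s => U (t + s) ψ) t t (by simpa using h3)
    simpa using h4
  -- Undoing the expected phase leaves a constant function.
  have hg : ∀ t : ℝ, HasDerivAt (fun t : ℝ => Complex.exp (Complex.I * (t * E)) • U t ψ) 0 t :=
    fun t => by
    have h1 : HasDerivAt (fun t : ℝ => Complex.I * ((t : ℂ) * E)) (Complex.I * (1 * E)) t :=
      ((Complex.ofRealCLM.hasDerivAt.mul_const _).const_mul _)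
    have h2 := h1.cexp.smul (hd t)
    refine h2.congr_deriv ?_
    rw [smul_neg, smul_smul, smul_smul, one_mul, mul_assoc, neg_add_cancel]
  have hc := is_const_of_deriv_eq_zero (fun t => (hg t).differentiableAt)
    (fun t => (hg t).deriv) t 0
  simp only [h0, Complex.ofReal_zero, zero_mul, mul_zero, Complex.exp_zero, one_smul,
    LinearIsometryEquiv.coe_one, id_eq] at hc
  rw [← hc, smul_smul, ← Complex.exp_add, neg_add_cancel, Complex.exp_zero, one_smul]
  simp [hc]

end EigenbasisGroup

/-! ## Gaussian Schwartz functions -/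

section Gaussian

open scoped ContDiff Nat

variable {E : Type*} [NormedAddCommGroup E] [InnerProductSpace ℝ E]

theorem one_add_pow_mul_exp_neg_le {c : ℝ} (hc : 0 < c) (N : ℕ) :
    ∃ K : ℝ, ∀ s : ℝ, 0 ≤ s → (1 + s) ^ N * Real.exp (-(c * s ^ 2)) ≤ K := by
  -- The power is at most `N! exp(1 + s)`, and `s - c s² ≤ 1/(4c)` by completing the square.
  refine ⟨N ! * Real.exp (1 + 1 / (4 * c)), fun s hs => ?_⟩
  have h1 : (1 + s) ^ N ≤ N ! * Real.exp (1 + s) := by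
    have := Real.pow_div_factorial_le_exp (1 + s) (by linarith) N
    rwa [div_le_iff₀ (by positivity), mul_comm] at this
  calc (1 + s) ^ N * Real.exp (-(c * s ^ 2))
      ≤ N ! * Real.exp (1 + s) * Real.exp (-(c * s ^ 2)) := by gcongr
    _ = N ! * Real.exp (1 + s - c * s ^ 2) := by
        rw [mul_assoc, ← Real.exp_add]; ring_nf
    _ ≤ N ! * Real.exp (1 + 1 / (4 * c)) := by
        gcongr
        have : 1 / (4 * c) - s + c * s ^ 2 = (2 * c * s - 1) ^ 2 / (4 * c) := by
          field_simp; ring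
        have : 0 ≤ 1 / (4 * c) - s + c * s ^ 2 := by rw [this]; positivity
        linarith

theorem iteratedDeriv_exp_norm (n : ℕ) (y : ℝ) :
    ‖iteratedFDeriv ℝ n Real.exp y‖ = Real.exp y := by
  rw [norm_iteratedFDeriv_eq_norm_iteratedDeriv, iteratedDeriv_eq_iterate, Real.iter_deriv_exp,
    Real.norm_eq_abs, abs_of_pos (Real.exp_pos _)]

/-- The Schwartz function `exp (-g)` for a function `g` of temperate growth that is bounded below
by a positive multiple of the square of the norm. -/
noncomputable def expNegS (g : E → ℝ) (hg : g.HasTemperateGrowth) {c : ℝ} (hc : 0 < c)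
    (hcg : ∀ x, c * ‖x‖ ^ 2 ≤ g x) : 𝓢(E, ℂ) where
  toFun x := ((Real.exp (-g x) : ℝ) : ℂ)
  smooth' := Complex.ofRealCLM.contDiff.comp (Real.contDiff_exp.comp hg.1.neg)
  decay' k n := by
    obtain ⟨l, C, hC, hl⟩ := hg.norm_iteratedFDeriv_le_uniform n
    obtain ⟨K, hK⟩ := one_add_pow_mul_exp_neg_le hc (k + l * n)
    refine ⟨n ! * (C + 1) ^ n * K, fun x => ?_⟩
    have hsm : ContDiff ℝ ∞ (Real.exp ∘ fun x => -g x) := Real.contDiff_exp.comp hg.1.neg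
    have h1 : ‖iteratedFDeriv ℝ n (fun x => ((Real.exp (-g x) : ℝ) : ℂ)) x‖ =
        ‖iteratedFDeriv ℝ n (Real.exp ∘ fun x => -g x) x‖ :=
      Complex.ofRealLI.norm_iteratedFDeriv_comp_left (hsm.contDiffAt) (mod_cast le_top)
    -- The Faà di Bruno bound asks that the `i`-th derivative of the exponent be at most the `i`-th
    -- power of one quantity. Using `C + 1` in place of `C` makes that quantity at least 1, so its
    -- powers with `i ≥ 1` dominate it.
    have h2 : ‖iteratedFDeriv ℝ n (Real.exp ∘ fun x => -g x) x‖ ≤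
        n ! * Real.exp (-g x) * ((C + 1) * (1 + ‖x‖) ^ l) ^ n := by
      refine norm_iteratedFDeriv_comp_le (N := ∞) Real.contDiff_exp hg.1.neg (mod_cast le_top) x
        (fun i _ => (iteratedDeriv_exp_norm i _).le) fun i hi1 hi => ?_
      have e1 : ‖iteratedFDeriv ℝ i (fun x => -g x) x‖ ≤ (C + 1) * (1 + ‖x‖) ^ l := by
        rw [show (fun x => -g x) = -g from rfl, iteratedFDeriv_neg_apply, norm_neg]
        exact (hl i hi x).trans (by gcongr; linarith)
      have e2 : 1 ≤ (C + 1) * (1 + ‖x‖) ^ l :=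
        one_le_mul_of_one_le_of_one_le (by linarith) (one_le_pow₀ (by linarith [norm_nonneg x]))
      exact e1.trans (le_self_pow₀ e2 (by omega))
    have hx := norm_nonneg x
    calc ‖x‖ ^ k * ‖iteratedFDeriv ℝ n (fun x => ((Real.exp (-g x) : ℝ) : ℂ)) x‖
        ≤ (1 + ‖x‖) ^ k * (n ! * Real.exp (-(c * ‖x‖ ^ 2)) * ((C + 1) * (1 + ‖x‖) ^ l) ^ n) := by
          rw [h1]
          gcongr
          · linarith
          · refine h2.trans ?_
            gcongr
            exact hcg x
      _ = n ! * (C + 1) ^ n * ((1 + ‖x‖) ^ (k + l * n) * Real.exp (-(c * ‖x‖ ^ 2))) := by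
          rw [mul_pow, ← pow_mul, pow_add]; ring
      _ ≤ n ! * (C + 1) ^ n * K := by
          gcongr
          exact hK _ hx

theorem expNegS_apply (g : E → ℝ) (hg : g.HasTemperateGrowth) {c : ℝ} (hc : 0 < c)
    (hcg : ∀ x, c * ‖x‖ ^ 2 ≤ g x) (x : E) :
    expNegS g hg hc hcg x = ((Real.exp (-g x) : ℝ) : ℂ) := rfl

/-! ### Completeness of polynomials times a Gaussian -/

variable [MeasurableSpace E] [BorelSpace E] [FiniteDimensional ℝ E]

/-- An integrable function whose Fourier transform vanishes is zero. -/
theorem ae_eq_zero_of_fourier_eq_zero {f : E → ℂ} (hf : Integrable f)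
    (h : ∀ w : E, FourierTransform.fourier f w = 0) : f =ᵐ[volume] 0 := by
  refine ae_eq_zero_of_integral_contDiff_smul_eq_zero hf.locallyIntegrable fun g hg hgc => ?_
  have hg' : ContDiff ℝ ∞ fun x => (g x : ℂ) := Complex.ofRealCLM.contDiff.comp hg
  have hgc' : HasCompactSupport fun x => (g x : ℂ) :=
    hgc.comp_left (g := Complex.ofReal) Complex.ofReal_zero
  let η : 𝓢(E, ℂ) := hgc'.toSchwartzMap hg'
  let χ : 𝓢(E, ℂ) := FourierTransformInv.fourierInv η
  have hη : ∀ x, FourierTransform.fourier (χ : E → ℂ) x = g x := fun x => by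
    rw [← SchwartzMap.fourier_coe]
    simp [χ, η]
  -- The test function is written as a Fourier transform, which is then moved onto `f`.
  have key := VectorFourier.integral_fourierIntegral_smul_eq_flip (μ := volume) (ν := volume)
    (L := innerₗ E) (f := χ) (g := f) Real.continuous_fourierChar continuous_inner
    χ.integrable hf
  have h1 : ∀ x, VectorFourier.fourierIntegral Real.fourierChar volume (innerₗ E) χ x = g x := hη
  have h2 : ∀ x, VectorFourier.fourierIntegral Real.fourierChar volume (innerₗ E).flip f x = 0 := by
    rw [flip_innerₗ]
    exact h
  simp only [h1, h2, smul_zero, integral_zero] at key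
  simpa using key

/-- Polynomials times a Gaussian are dense in `L²`. -/
theorem eq_zero_of_forall_integral_pow_mul_expNegS_eq_zero {g : E → ℝ} (hg : g.HasTemperateGrowth)
    {c : ℝ} (hc : 0 < c) (hcg : ∀ x, c * ‖x‖ ^ 2 ≤ g x) {F : E → ℂ} (hF : MemLp F 2)
    (h : ∀ (w : E) (m : ℕ),
      ∫ q, (((inner ℝ q w) ^ m : ℝ) : ℂ) * expNegS g hg hc hcg q * F q = 0) :
    F =ᵐ[volume] 0 := by
  have hgh : (fun x => g x / 2).HasTemperateGrowth := by
    simp_rw [div_eq_mul_inv]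
    exact hg.mul (.const _)
  -- The Gaussian is split into halves: one makes the product with `F` integrable, the other absorbs
  -- the exponential `exp(2π|⟨q, w⟩|)`.
  let G := expNegS (fun x => g x / 2) hgh (half_pos hc) fun x => by linarith [hcg x]
  have hGF : Integrable fun q => G q * F q := (G.memLp 2).integrable_mul hF
  have hdom : ∀ w : E, Integrable fun q =>
      Real.exp (2 * Real.pi * |inner ℝ q w|) * (Real.exp (-g q) * ‖F q‖) := fun w => by
    refine (hGF.norm.const_mul (Real.exp ((2 * Real.pi * ‖w‖) ^ 2 / (2 * c)))).mono ?_ ?_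
    · have := hg.1.continuous
      exact (by fun_prop : Continuous fun q => Real.exp (2 * Real.pi * |inner ℝ q w|)
        ).aestronglyMeasurable.mul ((by fun_prop : Continuous fun q => Real.exp (-g q)
        ).aestronglyMeasurable.mul hF.1.norm)
    · refine Filter.Eventually.of_forall fun q => ?_
      rw [Real.norm_of_nonneg (by positivity), Real.norm_of_nonneg (by positivity), norm_mul,
        ← mul_assoc, ← mul_assoc]
      refine mul_le_mul_of_nonneg_right ?_ (norm_nonneg _)
      rw [expNegS_apply, Complex.norm_real, Real.norm_of_nonneg (Real.exp_pos _).le,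
        ← Real.exp_add, ← Real.exp_add, Real.exp_le_exp]
      have e1 : 2 * Real.pi * |inner ℝ q w| ≤ 2 * Real.pi * ‖w‖ * ‖q‖ := by
        have := abs_real_inner_le_norm q w
        have hp := Real.pi_pos
        nlinarith
      have e2 : (2 * Real.pi * ‖w‖) ^ 2 / (2 * c) - 2 * Real.pi * ‖w‖ * ‖q‖ + c / 2 * ‖q‖ ^ 2 =
          (2 * Real.pi * ‖w‖ - c * ‖q‖) ^ 2 / (2 * c) := by
        field_simp; ring
      have e3 : 0 ≤ (2 * Real.pi * ‖w‖ - c * ‖q‖) ^ 2 / (2 * c) := by positivity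
      have e4 := hcg q
      linarith
  have hint : Integrable fun q => expNegS g hg hc hcg q * F q := by
    refine (hdom 0).mono ((expNegS g hg hc hcg).continuous.aestronglyMeasurable.mul hF.1)
      (Filter.Eventually.of_forall fun q => ?_)
    simp only [expNegS_apply, norm_mul, Complex.norm_real, inner_zero_right, abs_zero, mul_zero,
      Real.exp_zero, one_mul, Real.norm_eq_abs, Real.abs_exp, abs_norm, le_refl]
  -- Expanding the Fourier character in a power series gives moments that all vanish by hypothesis;
  -- the bound `hdom` permits termwise integration.
  have hzero := ae_eq_zero_of_fourier_eq_zero hint fun w => by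
    rw [Real.fourier_eq']
    have hs := hasSum_integral_of_dominated_convergence (μ := volume)
      (F := fun (m : ℕ) q => ((-2 * Real.pi * Complex.I) ^ m / m !) *
        ((((inner ℝ q w) ^ m : ℝ) : ℂ) * expNegS g hg hc hcg q * F q))
      (f := fun q => Complex.exp (((-2 * Real.pi * inner ℝ q w : ℝ) : ℂ) * Complex.I) •
        (expNegS g hg hc hcg q * F q))
      (bound := fun m q => (2 * Real.pi * |inner ℝ q w|) ^ m / m ! * (Real.exp (-g q) * ‖F q‖))
      (fun m => ?_) (fun m => Filter.Eventually.of_forall fun q => ?_)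
      (Filter.Eventually.of_forall fun q => ?_) ?_ (Filter.Eventually.of_forall fun q => ?_)
    · simp only [integral_const_mul, h, mul_zero] at hs
      exact hs.unique hasSum_zero
    · refine AEStronglyMeasurable.const_mul (AEStronglyMeasurable.mul
        (Continuous.aestronglyMeasurable ?_) hF.1) _
      have := (expNegS g hg hc hcg).continuous
      fun_prop
    · refine le_of_eq ?_
      simp only [expNegS_apply, norm_mul, norm_div, norm_pow, Complex.norm_real, Complex.norm_I,
        Complex.norm_natCast, Real.norm_eq_abs, abs_of_pos Real.pi_pos, Real.abs_exp, norm_neg,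
        Complex.norm_ofNat, mul_pow, one_pow]
      ring
    · exact ((Real.summable_pow_div_factorial _).mul_right _)
    · refine (hdom w).congr (Filter.Eventually.of_forall fun q => ?_)
      simp only [tsum_mul_right]
      rw [Real.exp_eq_exp_ℝ, NormedSpace.exp_eq_tsum_div]
    · have := NormedSpace.expSeries_div_hasSum_exp
        (((-2 * Real.pi * inner ℝ q w : ℝ) : ℂ) * Complex.I)
      rw [← Complex.exp_eq_exp_ℂ] at this
      refine (this.mul_right (expNegS g hg hc hcg q * F q)).congr_fun fun m => ?_
      push_cast
      ring
  filter_upwards [hzero] with q hq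
  rcases mul_eq_zero.1 hq with h0 | h0
  · rw [expNegS_apply] at h0
    exact absurd (Complex.ofReal_eq_zero.1 h0) (Real.exp_pos _).ne'
  · exact h0

end Gaussian

/-! ## The canonical commutation relations -/

section CCR

variable {ι : Type*} [Fintype ι]

/-- The commutator of operators on the Schwartz space, as a bilinear map. -/
noncomputable def commS :
    Module.End ℂ (Schw ι) →ₗ[ℂ] Module.End ℂ (Schw ι) →ₗ[ℂ] Module.End ℂ (Schw ι) :=
  LinearMap.mul ℂ _ - (LinearMap.mul ℂ _).flip

theorem commS_apply (A B : Module.End ℂ (Schw ι)) : commS A B = A * B - B * A := rfl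

theorem commS_swap (A B : Module.End ℂ (Schw ι)) : commS A B = -commS B A := by
  rw [commS_apply, commS_apply, neg_sub]

theorem commS_posS_posS (x y : ι) : commS (posS x) (posS y) = (0 : Module.End ℂ (Schw ι)) := by
  refine LinearMap.ext fun f => SchwartzMap.ext fun q => ?_
  rw [commS_apply, LinearMap.sub_apply, Module.End.mul_apply, Module.End.mul_apply, sub_apply,
    posS_apply, posS_apply, posS_apply, posS_apply, mul_left_comm, sub_self]
  rfl

/-- The operator `∑_x (α_x q_x + β_x p_x)`. -/
noncomputable def linOp (α β : ι → ℂ) : Module.End ℂ (Schw ι) :=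
  ∑ x, (α x • posS x + β x • momS x)

theorem formalAdj_linOp (α β : ι → ℂ) : FormalAdj (linOp α β)
    (linOp (fun x => (starRingEnd ℂ) (α x)) fun x => (starRingEnd ℂ) (β x)) :=
  FormalAdj.sum _ fun x _ => ((formalAdj_posS x).smul _).add ((formalAdj_momS x).smul _)

theorem linOp_add (α β α' β' : ι → ℂ) :
    linOp α β + linOp α' β' = linOp (α + α') (β + β') := by
  simp only [linOp, ← Finset.sum_add_distrib, Pi.add_apply, add_smul]
  exact Finset.sum_congr rfl fun x _ => by abel

theorem smul_linOp (c : ℂ) (α β : ι → ℂ) : c • linOp α β = linOp (c • α) (c • β) := by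
  simp only [linOp, Finset.smul_sum, smul_add, smul_smul, Pi.smul_apply, smul_eq_mul]

theorem sum_linOp {κ : Type*} (s : Finset κ) (α β : κ → ι → ℂ) :
    ∑ j ∈ s, linOp (α j) (β j) = linOp (∑ j ∈ s, α j) (∑ j ∈ s, β j) := by
  simp only [linOp, Finset.sum_apply, Finset.sum_smul, ← Finset.sum_add_distrib]
  exact Finset.sum_comm

variable [DecidableEq ι]

/-- This is the symmetry of second derivatives. -/
theorem commS_momS_momS (x y : ι) : commS (momS x) (momS y) = (0 : Module.End ℂ (Schw ι)) := by
  refine LinearMap.ext fun f => SchwartzMap.ext fun q => ?_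
  have hd : DifferentiableAt ℝ (fderiv ℝ f) q :=
    ((f.smooth 2).fderiv_right (m := 1) (by norm_num)).differentiable (by norm_num) q
  have h : ∀ x y : ι, momS x (momS y f) q = -Complex.I * (-Complex.I *
      fderiv ℝ (fderiv ℝ f) q (EuclideanSpace.single x (1 : ℝ))
        (EuclideanSpace.single y (1 : ℝ))) := fun x y => by
    rw [momS_apply]
    congr 1
    have e : (momS y f : EuclideanSpace ℝ ι → ℂ) =
        fun q => -Complex.I * fderiv ℝ f q (EuclideanSpace.single y (1 : ℝ)) :=
      funext fun q => momS_apply y f q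
    have h1 : HasFDerivAt (fun q => fderiv ℝ f q (EuclideanSpace.single y (1 : ℝ)))
        ((fderiv ℝ (fderiv ℝ f) q).flip (EuclideanSpace.single y (1 : ℝ))) q := by
      simpa using hd.hasFDerivAt.clm_apply (hasFDerivAt_const (EuclideanSpace.single y (1 : ℝ)) q)
    rw [e, (h1.const_mul (-Complex.I)).fderiv]
    rfl
  have hs : IsSymmSndFDerivAt ℝ f q :=
    (f.smooth 2).contDiffAt.isSymmSndFDerivAt (by simp)
  rw [commS_apply, LinearMap.sub_apply, Module.End.mul_apply, Module.End.mul_apply, sub_apply,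
    h, h, hs.eq, sub_self]
  rfl

theorem commS_posS_momS (x y : ι) : commS (posS x) (momS y) =
    ((if x = y then Complex.I else 0) • 1 : Module.End ℂ (Schw ι)) := by
  refine LinearMap.ext fun f => SchwartzMap.ext fun q => ?_
  have e : (posS x f : EuclideanSpace ℝ ι → ℂ) = fun q => ((q x : ℝ) : ℂ) * f q :=
    funext fun q => posS_apply x f q
  have h1 : HasFDerivAt (fun q : EuclideanSpace ℝ ι => ((q x : ℝ) : ℂ))
      (Complex.ofRealCLM.comp (EuclideanSpace.proj x : EuclideanSpace ℝ ι →L[ℝ] ℝ)) q :=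
    (Complex.ofRealCLM.comp (EuclideanSpace.proj x : EuclideanSpace ℝ ι →L[ℝ] ℝ)).hasFDerivAt
  have h2 : fderiv ℝ (posS x f) q (EuclideanSpace.single y (1 : ℝ)) =
      (q x : ℂ) * fderiv ℝ f q (EuclideanSpace.single y (1 : ℝ)) +
        f q * if x = y then 1 else 0 := by
    rw [e, (h1.fun_mul (f.hasFDerivAt q)).fderiv]
    by_cases hxy : x = y <;> simp [hxy]
  rw [commS_apply, LinearMap.sub_apply, Module.End.mul_apply, Module.End.mul_apply, sub_apply,
    posS_apply, momS_apply, momS_apply, h2, LinearMap.smul_apply, smul_apply, Module.End.one_apply,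
    smul_eq_mul]
  split_ifs <;> ring

/-- By bilinearity only the canonical pairs contribute, giving the symplectic form of the
coefficient vectors. All ladder and evolved commutators are read off from it. -/
theorem commS_linOp_linOp (α β α' β' : ι → ℂ) : commS (linOp α β) (linOp α' β') =
    (Complex.I * ∑ x, (α x * β' x - β x * α' x)) • (1 : Module.End ℂ (Schw ι)) := by
  have h : ∀ x y : ι, commS (α x • posS x + β x • momS x) (α' y • posS y + β' y • momS y) =
      (if x = y then Complex.I * (α x * β' y - β x * α' y) else 0) •
        (1 : Module.End ℂ (Schw ι)) := fun x y => by
    have h' : commS (momS x) (posS y) =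
        (-(if y = x then Complex.I else 0) • 1 : Module.End ℂ (Schw ι)) := by
      rw [commS_swap, commS_posS_momS, neg_smul]
    simp only [map_add, map_smul, LinearMap.add_apply, LinearMap.smul_apply, commS_posS_posS,
      commS_momS_momS, commS_posS_momS,
      h', smul_zero, zero_add, add_zero, smul_smul, ← add_smul]
    congr 1
    by_cases hxy : x = y
    · simp only [hxy, if_true]; ring
    · simp [hxy, Ne.symm hxy]
  simp only [linOp, map_sum, LinearMap.sum_apply, h, ← Finset.sum_smul, Finset.sum_ite_eq',
    Finset.mem_univ, if_true, Finset.mul_sum]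

theorem posS_eq_linOp (x : ι) : posS x = linOp (Pi.single x 1) 0 := by
  simp [linOp, Pi.single_apply]

theorem momS_eq_linOp (x : ι) : momS x = linOp 0 (Pi.single x 1) := by
  simp [linOp, Pi.single_apply]

end CCR

/-! ## Normal modes and the Fock basis -/

/-- Normal modes of a system of coupled oscillators: the `j`-th mode has frequency `ω j`, position
`Q_j = ∑_x O_{x,j} s_x⁻¹ q_x` and momentum `P_j = ∑_x O_{x,j} s_x p_x`, where `O` is orthogonal. -/
structure NormalModes (ι : Type*) [Fintype ι] [DecidableEq ι] where
  O : Matrix ι ι ℝ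
  s : ι → ℝ
  ω : ι → ℝ
  s_pos : ∀ x, 0 < s x
  ω_pos : ∀ j, 0 < ω j
  orth : O.transpose * O = 1

namespace NormalModes

variable {ι : Type*} [Fintype ι] [DecidableEq ι] (M : NormalModes ι)

theorem sum_col (j k : ι) : ∑ x, M.O x j * M.O x k = if j = k then 1 else 0 := by
  have := congrFun (congrFun M.orth j) k
  simpa [Matrix.mul_apply, Matrix.one_apply] using this

theorem sum_row (x y : ι) : ∑ j, M.O x j * M.O y j = if x = y then 1 else 0 := by
  have h : M.O * M.O.transpose = 1 := mul_eq_one_comm.1 M.orth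
  have := congrFun (congrFun h x) y
  simpa [Matrix.mul_apply, Matrix.one_apply] using this

/-- The annihilation operator `ω_j Q_j + i P_j`. -/
noncomputable def ann (j : ι) : Module.End ℂ (Schw ι) :=
  linOp (fun x => ((M.ω j * M.O x j / M.s x : ℝ) : ℂ)) fun x => Complex.I * (M.O x j * M.s x : ℝ)

/-- The creation operator `ω_j Q_j - i P_j`. -/
noncomputable def cre (j : ι) : Module.End ℂ (Schw ι) :=
  linOp (fun x => ((M.ω j * M.O x j / M.s x : ℝ) : ℂ)) fun x => -Complex.I * (M.O x j * M.s x : ℝ)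

theorem formalAdj_cre_ann (j : ι) : FormalAdj (M.cre j) (M.ann j) := by
  simpa [cre, ann] using formalAdj_linOp (fun x => ((M.ω j * M.O x j / M.s x : ℝ) : ℂ))
    fun x => -Complex.I * (M.O x j * M.s x : ℝ)

/-- With `ε, δ = ±i` this covers all pairs of creation and annihilation operators at once. The
weights `s_x` cancel, and orthogonality of the columns of `O` does the rest. -/
theorem commS_ladder (j k : ι) (ε δ : ℂ) :
    commS (linOp (fun x => ((M.ω j * M.O x j / M.s x : ℝ) : ℂ)) fun x => ε * (M.O x j * M.s x : ℝ))
      (linOp (fun x => ((M.ω k * M.O x k / M.s x : ℝ) : ℂ)) fun x => δ * (M.O x k * M.s x : ℝ)) =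
    (if j = k then Complex.I * (δ - ε) * M.ω j else 0) • (1 : Module.End ℂ (Schw ι)) := by
  rw [commS_linOp_linOp]
  congr 1
  have h : ∀ x, ((M.ω j * M.O x j / M.s x : ℝ) : ℂ) * (δ * (M.O x k * M.s x : ℝ)) -
      ε * (M.O x j * M.s x : ℝ) * ((M.ω k * M.O x k / M.s x : ℝ) : ℂ) =
      (δ * M.ω j - ε * M.ω k) * ((M.O x j * M.O x k : ℝ) : ℂ) := fun x => by
    have := Complex.ofReal_ne_zero.2 (M.s_pos x).ne'
    push_cast
    field_simp
  simp only [h, ← Finset.mul_sum]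
  rw [← Complex.ofReal_sum, M.sum_col]
  split_ifs with hjk
  · rw [hjk]; push_cast; ring
  · simp

theorem commS_ann_cre (j k : ι) : commS (M.ann j) (M.cre k) =
    (if j = k then 2 * (M.ω j : ℂ) else 0) • (1 : Module.End ℂ (Schw ι)) := by
  rw [ann, cre, commS_ladder]
  congr 2
  rw [show Complex.I * (-Complex.I - Complex.I) = -2 * (Complex.I * Complex.I) by ring,
    Complex.I_mul_I]
  norm_num

theorem commS_cre_cre (j k : ι) : commS (M.cre j) (M.cre k) = 0 := by
  rw [cre, cre, commS_ladder]
  simp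

theorem commS_ann_ann (j k : ι) : commS (M.ann j) (M.ann k) = 0 := by
  rw [ann, ann, commS_ladder]
  simp

theorem ann_cre_apply (j k : ι) (f : Schw ι) : M.ann j (M.cre k f) =
    M.cre k (M.ann j f) + (if j = k then 2 * (M.ω j : ℂ) else 0) • f := by
  have h := LinearMap.congr_fun (M.commS_ann_cre j k) f
  rw [commS_apply, LinearMap.sub_apply, sub_eq_iff_eq_add'] at h
  exact h

theorem cre_comm_apply (j k : ι) (f : Schw ι) : M.cre j (M.cre k f) = M.cre k (M.cre j f) := by
  have h := LinearMap.congr_fun (M.commS_cre_cre j k) f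
  rw [commS_apply, LinearMap.sub_apply] at h
  exact sub_eq_zero.1 h

theorem ann_comm_apply (j k : ι) (f : Schw ι) : M.ann j (M.ann k f) = M.ann k (M.ann j f) := by
  have h := LinearMap.congr_fun (M.commS_ann_ann j k) f
  rw [commS_apply, LinearMap.sub_apply] at h
  exact sub_eq_zero.1 h

/-! ### The vacuum -/

/-- The value of the mode coordinate `Q_j`. -/
noncomputable def coord (j : ι) : EuclideanSpace ℝ ι →L[ℝ] ℝ :=
  ∑ x, (M.O x j / M.s x) • (EuclideanSpace.proj x : EuclideanSpace ℝ ι →L[ℝ] ℝ)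

theorem coord_apply (j : ι) (q : EuclideanSpace ℝ ι) :
    M.coord j q = ∑ x, M.O x j / M.s x * q x := by
  simp [coord]

/-- The exponent `½ ∑_j ω_j Q_j²`. -/
noncomputable def vacExp (q : EuclideanSpace ℝ ι) : ℝ := ∑ j, M.ω j / 2 * M.coord j q ^ 2

theorem vacExp_hasTemperateGrowth : M.vacExp.HasTemperateGrowth :=
  Function.HasTemperateGrowth.sum fun j _ =>
    (Function.HasTemperateGrowth.const (M.ω j / 2)).mul ((M.coord j).hasTemperateGrowth.pow 2)

theorem sum_coord (x : ι) (q : EuclideanSpace ℝ ι) :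
    M.s x * ∑ j, M.O x j * M.coord j q = q x := by
  have : ∑ j, M.O x j * M.coord j q = ∑ y, (∑ j, M.O x j * M.O y j) * (q y / M.s y) := by
    simp only [coord_apply, Finset.mul_sum, Finset.sum_mul]
    rw [Finset.sum_comm]
    exact Finset.sum_congr rfl fun y _ => Finset.sum_congr rfl fun j _ => by ring
  rw [this]
  simp only [sum_row, ite_mul, one_mul, zero_mul, Finset.sum_ite_eq, Finset.mem_univ, if_true]
  rw [mul_div_cancel₀ _ (M.s_pos x).ne']

theorem exists_le_vacExp : ∃ c : ℝ, 0 < c ∧ ∀ q, c * ‖q‖ ^ 2 ≤ M.vacExp q := by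
  -- The summand 1 keeps the constant positive even when there are no sites.
  have hK : 0 < 1 + ∑ x, M.s x ^ 2 * ∑ j, 2 / M.ω j := by
    have : 0 ≤ ∑ x, M.s x ^ 2 * ∑ j, 2 / M.ω j :=
      Finset.sum_nonneg fun x _ => mul_nonneg (sq_nonneg _)
        (Finset.sum_nonneg fun j _ => div_nonneg zero_le_two (M.ω_pos j).le)
    linarith
  have hv : ∀ q, 0 ≤ M.vacExp q := fun q =>
    Finset.sum_nonneg fun j _ => mul_nonneg (half_pos (M.ω_pos j)).le (sq_nonneg _)
  refine ⟨(1 + ∑ x, M.s x ^ 2 * ∑ j, 2 / M.ω j)⁻¹, inv_pos.2 hK, fun q => ?_⟩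
  rw [inv_mul_le_iff₀ hK, EuclideanSpace.norm_sq_eq]
  have h1 : ∀ x, ‖q x‖ ^ 2 ≤ M.s x ^ 2 * (∑ j, 2 / M.ω j) * M.vacExp q := fun x => by
    rw [Real.norm_eq_abs, sq_abs, ← M.sum_coord x q, mul_pow, mul_assoc]
    refine mul_le_mul_of_nonneg_left ?_ (sq_nonneg _)
    -- Cauchy–Schwarz in the inversion formula for `q x`; the rows of `O` are unit vectors.
    have hcs := Finset.sum_mul_sq_le_sq_mul_sq Finset.univ (M.O x) fun j => M.coord j q
    have h2 : ∑ j, M.O x j ^ 2 = 1 := by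
      have := M.sum_row x x
      simpa [pow_two] using this
    rw [h2, one_mul] at hcs
    refine hcs.trans ?_
    rw [Finset.sum_mul]
    refine Finset.sum_le_sum fun j _ => ?_
    have h3 : M.ω j / 2 * M.coord j q ^ 2 ≤ M.vacExp q :=
      Finset.single_le_sum (f := fun j => M.ω j / 2 * M.coord j q ^ 2)
        (fun j _ => mul_nonneg (half_pos (M.ω_pos j)).le (sq_nonneg _)) (Finset.mem_univ j)
    calc M.coord j q ^ 2 = 2 / M.ω j * (M.ω j / 2 * M.coord j q ^ 2) := by
          have := (M.ω_pos j).ne'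
          field_simp
      _ ≤ _ := mul_le_mul_of_nonneg_left h3 (div_nonneg zero_le_two (M.ω_pos j).le)
  refine (Finset.sum_le_sum fun x _ => h1 x).trans ?_
  rw [← Finset.sum_mul]
  exact mul_le_mul_of_nonneg_right (by linarith) (hv q)

/-- The ground state `exp (-½ ∑_j ω_j Q_j²)`. -/
noncomputable def vac : Schw ι :=
  expNegS M.vacExp M.vacExp_hasTemperateGrowth M.exists_le_vacExp.choose_spec.1
    M.exists_le_vacExp.choose_spec.2

theorem linOp_apply (α β : ι → ℂ) (f : Schw ι) (q : EuclideanSpace ℝ ι) :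
    linOp α β f q = ∑ x, (α x * posS x f q + β x * momS x f q) := by
  have h : ∀ (s : Finset ι), (∑ x ∈ s, (α x • posS x + β x • momS x)) f q =
      ∑ x ∈ s, (α x * posS x f q + β x * momS x f q) := fun s => by
    induction s using Finset.induction_on with
    | empty => rfl
    | insert a s ha ih =>
      rw [Finset.sum_insert ha, Finset.sum_insert ha, ← ih]
      rfl
  exact h _

theorem fderiv_vac (q v : EuclideanSpace ℝ ι) :
    fderiv ℝ M.vac q v = -((∑ j, M.ω j * M.coord j q * M.coord j v : ℝ) : ℂ) * M.vac q := by
  have h1 : HasFDerivAt M.vacExp (∑ j, (M.ω j / 2) • ((2 * M.coord j q) • M.coord j)) q := by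
    refine HasFDerivAt.fun_sum fun j _ => HasFDerivAt.const_mul ?_ _
    simpa using (M.coord j).hasFDerivAt.pow 2
  have h2 : HasFDerivAt M.vac (Complex.ofRealCLM.comp (Real.exp (-M.vacExp q) •
      -∑ j, (M.ω j / 2) • ((2 * M.coord j q) • M.coord j))) q :=
    Complex.ofRealCLM.hasFDerivAt.comp q h1.neg.exp
  rw [h2.fderiv, vac, expNegS_apply]
  simp only [ContinuousLinearMap.comp_apply, smul_apply, neg_apply,
    sum_apply, Complex.ofRealCLM_apply, smul_eq_mul]
  rw [← Complex.ofReal_neg, ← Complex.ofReal_mul, mul_comm]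
  congr 3
  exact Finset.sum_congr rfl fun j _ => by ring

/-- On the Gaussian, `i P_j` is differentiation along the `j`-th mode and produces `-ω_j Q_j`, which
cancels the other term. -/
theorem ann_vac (j : ι) : M.ann j M.vac = 0 := by
  ext q
  rw [ann, linOp_apply]
  have h : ∀ x, ((M.ω j * M.O x j / M.s x : ℝ) : ℂ) * posS x M.vac q +
      Complex.I * (M.O x j * M.s x : ℝ) * momS x M.vac q =
      ((M.ω j * (M.O x j / M.s x * q x) -
        ∑ k, M.ω k * M.coord k q * (M.O x j * M.O x k) : ℝ) : ℂ) * M.vac q := fun x => by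
    have h1 : ∑ k, M.ω k * M.coord k q * (M.O x j * M.O x k) = M.O x j * M.s x *
        ∑ k, M.ω k * M.coord k q * M.coord k (EuclideanSpace.single x 1) := by
      rw [Finset.mul_sum]
      refine Finset.sum_congr rfl fun k _ => ?_
      have := (M.s_pos x).ne'
      simp only [coord_apply, PiLp.single_apply, mul_ite, mul_one, mul_zero, Finset.sum_ite_eq',
        Finset.mem_univ, if_true]
      field_simp
    rw [posS_apply, momS_apply, fderiv_vac, h1]
    push_cast
    linear_combination (-(M.O x j : ℂ) * M.s x *
      (∑ k, (M.ω k : ℂ) * M.coord k q * M.coord k (EuclideanSpace.single x 1)) *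
        M.vac q * (-1)) * Complex.I_mul_I
  simp only [h, ← Finset.sum_mul]
  rw [← Complex.ofReal_sum, Finset.sum_sub_distrib, ← Finset.mul_sum, ← coord_apply,
    Finset.sum_comm]
  simp only [← Finset.mul_sum, sum_col]
  simp

end NormalModes

namespace NormalModes

variable {ι : Type*} [Fintype ι] [DecidableEq ι] (M : NormalModes ι)

/-! ### The Fock vectors -/

/-- This makes folding over a multiset well defined, so multisets can serve as occupation numbers.
-/
instance : LeftCommutative fun (j : ι) (f : Schw ι) => M.cre j f :=
  ⟨fun j k f => M.cre_comm_apply j k f⟩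

/-- The vector obtained from the vacuum by creating the modes in the multiset `n`. -/
noncomputable def fock (n : Multiset ι) : Schw ι := n.foldr (fun j f => M.cre j f) M.vac

theorem fock_zero : M.fock 0 = M.vac := rfl

theorem fock_cons (j : ι) (n : Multiset ι) : M.fock (j ::ₘ n) = M.cre j (M.fock n) :=
  Multiset.foldr_cons _ _ _ _

/-- Moving `a_j` through the creation operators picks up `2 ω_j` for each occurrence of `j`, until
it annihilates the vacuum. -/
theorem cre_ann_fock (j : ι) (n : Multiset ι) :
    M.cre j (M.ann j (M.fock n)) = (2 * M.ω j * n.count j : ℂ) • M.fock n := by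
  induction n using Multiset.induction_on with
  | empty => simp [fock_zero, ann_vac]
  | cons k n ih =>
    rw [fock_cons, ann_cre_apply, map_add, cre_comm_apply, ih, map_smul, map_smul]
    by_cases h : j = k
    · subst h
      rw [if_pos rfl, ← add_smul, Multiset.count_cons_self]
      congr 1; push_cast; ring
    · rw [if_neg h, zero_smul, add_zero, Multiset.count_cons_of_ne h]

/-- The Hamiltonian `∑_j (a_j† a_j + ω_j)`. -/
noncomputable def ham : Module.End ℂ (Schw ι) :=
  ∑ j, (M.cre j * M.ann j + (M.ω j : ℂ) • 1)

/-- The energy of a Fock vector. -/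
noncomputable def energy (n : Multiset ι) : ℝ := ∑ j, (2 * M.ω j * n.count j + M.ω j)

theorem ham_fock (n : Multiset ι) : M.ham (M.fock n) = (M.energy n : ℂ) • M.fock n := by
  rw [ham, energy, LinearMap.sum_apply, Complex.ofReal_sum, Finset.sum_smul]
  refine Finset.sum_congr rfl fun j _ => ?_
  rw [LinearMap.add_apply, Module.End.mul_apply, cre_ann_fock, LinearMap.smul_apply,
    Module.End.one_apply, ← add_smul]
  push_cast
  rfl

theorem formalAdj_ham : FormalAdj M.ham M.ham := by
  refine FormalAdj.sum _ fun j _ => ((M.formalAdj_cre_ann j).mul (M.formalAdj_cre_ann j).symm).add ?_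
  have := (FormalAdj.one (ι := ι)).smul (M.ω j : ℂ)
  rwa [Complex.conj_ofReal] at this

theorem ham_ann (j : ι) (f : Schw ι) :
    M.ham (M.ann j f) = M.ann j (M.ham f) - (2 * M.ω j : ℂ) • M.ann j f := by
  have h : ∀ k, M.cre k (M.ann k (M.ann j f)) = M.ann j (M.cre k (M.ann k f)) -
      (if j = k then 2 * (M.ω j : ℂ) else 0) • M.ann k f := fun k => by
    rw [ann_cre_apply, M.ann_comm_apply k j, add_sub_cancel_right]
  simp only [ham, LinearMap.sum_apply, LinearMap.add_apply, Module.End.mul_apply, h, map_sum,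
    map_add, LinearMap.smul_apply, Module.End.one_apply, map_smul]
  simp only [sub_add_eq_add_sub, Finset.sum_sub_distrib]
  simp

theorem ham_cre (j : ι) (f : Schw ι) :
    M.ham (M.cre j f) = M.cre j (M.ham f) + (2 * M.ω j : ℂ) • M.cre j f := by
  have h : ∀ k, M.cre k (M.ann k (M.cre j f)) = M.cre j (M.cre k (M.ann k f)) +
      (if k = j then 2 * (M.ω k : ℂ) else 0) • M.cre k f := fun k => by
    rw [ann_cre_apply, map_add, map_smul, cre_comm_apply]
  simp only [ham, LinearMap.sum_apply, LinearMap.add_apply, Module.End.mul_apply, h, map_sum,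
    map_add, LinearMap.smul_apply, Module.End.one_apply, map_smul]
  rw [← sub_eq_iff_eq_add', ← Finset.sum_sub_distrib]
  simp only [add_sub_add_right_eq_sub, add_sub_cancel_left]
  simp

/-! ### Orthogonality -/

/-- A consequence of the commutation relation; since `ω_j > 0`, creation operators never kill a
nonzero vector. -/
theorem norm_sq_cre (j : ι) (f : Schw ι) : ‖schwToL2 ι (M.cre j f)‖ ^ 2 =
    ‖schwToL2 ι (M.ann j f)‖ ^ 2 + 2 * M.ω j * ‖schwToL2 ι f‖ ^ 2 := by
  have h := M.formalAdj_cre_ann j f (M.cre j f)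
  rw [ann_cre_apply, if_pos rfl, map_add, inner_add_right, ← (M.formalAdj_cre_ann j).symm f,
    map_smul, inner_smul_right, inner_self_eq_norm_sq_to_K, inner_self_eq_norm_sq_to_K,
    inner_self_eq_norm_sq_to_K] at h
  simp only [Complex.coe_algebraMap] at h
  exact_mod_cast h

theorem fock_ne_zero (n : Multiset ι) : schwToL2 ι (M.fock n) ≠ 0 := by
  induction n using Multiset.induction_on with
  | empty =>
    rw [fock_zero]
    intro h
    have h0 : M.vac = 0 := schwToL2_injective ι (by rw [h, map_zero])
    have h1 : M.vac 0 = 0 := by rw [h0]; rfl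
    rw [vac, expNegS_apply] at h1
    exact (Real.exp_pos _).ne' (Complex.ofReal_eq_zero.1 h1)
  | cons k n ih =>
    rw [fock_cons, ← norm_pos_iff]
    have h := M.norm_sq_cre k (M.fock n)
    have h1 := M.ω_pos k
    have h2 := norm_pos_iff.2 ih
    have h3 : 0 < ‖schwToL2 ι (M.cre k (M.fock n))‖ ^ 2 := by rw [h]; positivity
    exact (norm_nonneg _).lt_of_ne fun h0 => by simp [← h0] at h3

/-- Some single-mode operator `a_j† a_j` has different eigenvalues on the two vectors. The total
energy would not suffice, since distinct occupation numbers may share an energy. -/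
theorem inner_fock_of_ne {n m : Multiset ι} (h : n ≠ m) :
    inner ℂ (schwToL2 ι (M.fock n)) (schwToL2 ι (M.fock m)) = 0 := by
  obtain ⟨j, hj⟩ : ∃ j, n.count j ≠ m.count j := by
    by_contra! hc
    exact h (Multiset.ext.2 hc)
  have hN := ((M.formalAdj_cre_ann j).mul (M.formalAdj_cre_ann j).symm) (M.fock n) (M.fock m)
  rw [Module.End.mul_apply, Module.End.mul_apply, cre_ann_fock, cre_ann_fock, map_smul, map_smul,
    inner_smul_left, inner_smul_right] at hN
  simp only [map_mul, Complex.conj_ofReal, map_ofNat, map_natCast] at hN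
  have h2 : ((2 * M.ω j : ℝ) : ℂ) ≠ 0 :=
    Complex.ofReal_ne_zero.2 (mul_pos two_pos (M.ω_pos j)).ne'
  have h3 : (n.count j : ℂ) - m.count j ≠ 0 := sub_ne_zero.2 (by exact_mod_cast hj)
  have h4 : ((2 * M.ω j : ℝ) : ℂ) * ((n.count j : ℂ) - m.count j) *
      inner ℂ (schwToL2 ι (M.fock n)) (schwToL2 ι (M.fock m)) = 0 := by
    push_cast
    linear_combination hN
  exact (mul_eq_zero.1 h4).resolve_left (mul_ne_zero h2 h3)

/-- The normalized Fock vectors. -/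
noncomputable def fockUnit (n : Multiset ι) : Schw ι :=
  ((‖schwToL2 ι (M.fock n)‖⁻¹ : ℝ) : ℂ) • M.fock n

theorem orthonormal_fockUnit : Orthonormal ℂ fun n => schwToL2 ι (M.fockUnit n) := by
  refine ⟨fun n => ?_, fun n m h => ?_⟩
  · change ‖schwToL2 ι (M.fockUnit n)‖ = 1
    rw [fockUnit, map_smul, norm_smul, Complex.norm_real, norm_inv, norm_norm,
      inv_mul_cancel₀ (norm_ne_zero_iff.2 (M.fock_ne_zero n))]
  · simp only [fockUnit, map_smul, inner_smul_left, inner_smul_right, M.inner_fock_of_ne h, mul_zero]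

/-! ### The span of the Fock vectors -/

/-- The space of finite linear combinations of Fock vectors. -/
noncomputable def fockSpan : Submodule ℂ (Schw ι) := Submodule.span ℂ (Set.range M.fock)

theorem fock_mem (n : Multiset ι) : M.fock n ∈ M.fockSpan := Submodule.subset_span ⟨n, rfl⟩

theorem map_mem_fockSpan {A : Module.End ℂ (Schw ι)} (h : ∀ n, A (M.fock n) ∈ M.fockSpan)
    {f : Schw ι} (hf : f ∈ M.fockSpan) : A f ∈ M.fockSpan := by
  have : M.fockSpan ≤ M.fockSpan.comap A := by
    refine Submodule.span_le.2 ?_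
    rintro _ ⟨n, rfl⟩
    exact h n
  exact this hf

theorem cre_mem (j : ι) {f : Schw ι} (hf : f ∈ M.fockSpan) : M.cre j f ∈ M.fockSpan :=
  M.map_mem_fockSpan (fun n => by rw [← fock_cons]; exact M.fock_mem _) hf

theorem ann_mem (j : ι) {f : Schw ι} (hf : f ∈ M.fockSpan) : M.ann j f ∈ M.fockSpan := by
  refine M.map_mem_fockSpan (fun n => ?_) hf
  induction n using Multiset.induction_on with
  | empty => rw [fock_zero, ann_vac]; exact zero_mem _
  | cons k n ih =>
    rw [fock_cons, ann_cre_apply]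
    exact add_mem (M.cre_mem k ih) (Submodule.smul_mem _ _ (M.fock_mem n))

theorem posS_eq_sum (x : ι) : posS x =
    ∑ j, ((M.s x * M.O x j / (2 * M.ω j) : ℝ) : ℂ) • (M.ann j + M.cre j) := by
  simp only [posS_eq_linOp, ann, cre, linOp_add, smul_linOp, sum_linOp]
  congr 1
  · ext y
    have h : ∀ j, ((M.s x * M.O x j / (2 * M.ω j) : ℝ) : ℂ) *
        (((M.ω j * M.O y j / M.s y : ℝ) : ℂ) + ((M.ω j * M.O y j / M.s y : ℝ) : ℂ)) =
        ((M.s x / M.s y * (M.O x j * M.O y j) : ℝ) : ℂ) := fun j => by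
      have h1 := (M.ω_pos j).ne'
      have h2 := (M.s_pos y).ne'
      norm_cast
      field_simp
      ring
    simp only [Finset.sum_apply, Pi.smul_apply, Pi.add_apply, smul_eq_mul, h]
    rw [← Complex.ofReal_sum, ← Finset.mul_sum, sum_row]
    by_cases hxy : x = y
    · subst hxy; simp [(M.s_pos x).ne']
    · simp [hxy, Ne.symm hxy]
  · ext y
    simp

theorem momS_eq_sum (x : ι) : momS x =
    ∑ j, (-Complex.I * (M.O x j / (2 * M.s x) : ℝ)) • (M.ann j + (-1 : ℂ) • M.cre j) := by
  simp only [momS_eq_linOp, ann, cre, smul_linOp, linOp_add, sum_linOp]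
  congr 1
  · ext y
    simp
  · ext y
    have h : ∀ j, (-Complex.I * (M.O x j / (2 * M.s x) : ℝ)) *
        (Complex.I * (M.O y j * M.s y : ℝ) + -1 * (-Complex.I * (M.O y j * M.s y : ℝ))) =
        ((M.s y / M.s x * (M.O x j * M.O y j) : ℝ) : ℂ) := fun j => by
      have h2 := Complex.ofReal_ne_zero.2 (M.s_pos x).ne'
      push_cast
      field_simp
      linear_combination (-2 * (M.O x j : ℂ) * M.O y j * M.s y) * Complex.I_mul_I
    simp only [Finset.sum_apply, Pi.smul_apply, Pi.add_apply, smul_eq_mul, h]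
    rw [← Complex.ofReal_sum, ← Finset.mul_sum, sum_row]
    by_cases hxy : x = y
    · subst hxy; simp [(M.s_pos x).ne']
    · simp [hxy, Ne.symm hxy]

theorem posS_mem (x : ι) {f : Schw ι} (hf : f ∈ M.fockSpan) : posS x f ∈ M.fockSpan := by
  rw [M.posS_eq_sum, LinearMap.sum_apply]
  exact sum_mem fun j _ => Submodule.smul_mem _ _ (add_mem (M.ann_mem j hf) (M.cre_mem j hf))

theorem momS_mem (x : ι) {f : Schw ι} (hf : f ∈ M.fockSpan) : momS x f ∈ M.fockSpan := by
  rw [M.momS_eq_sum, LinearMap.sum_apply]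
  exact sum_mem fun j _ => Submodule.smul_mem _ _ (add_mem (M.ann_mem j hf)
    (Submodule.smul_mem _ _ (M.cre_mem j hf)))

/-! ### Completeness -/

/-- Multiplication by `⟨q, w⟩` is a combination of positions, and these preserve the Fock span
because they are sums of ladder operators. -/
theorem exists_mem_fockSpan_pow (w : EuclideanSpace ℝ ι) (m : ℕ) :
    ∃ f ∈ M.fockSpan, ∀ q, f q = (((inner ℝ q w) ^ m : ℝ) : ℂ) * M.vac q := by
  induction m with
  | zero => exact ⟨M.vac, M.fock_mem 0, fun q => by simp⟩
  | succ m ih =>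
    obtain ⟨f, hf, hfq⟩ := ih
    refine ⟨linOp (fun x => (w x : ℂ)) 0 f, ?_, fun q => ?_⟩
    · rw [linOp, LinearMap.sum_apply]
      refine sum_mem fun x _ => ?_
      rw [Pi.zero_apply, zero_smul, add_zero]
      exact Submodule.smul_mem _ _ (M.posS_mem x hf)
    · rw [linOp_apply]
      simp only [Pi.zero_apply, zero_mul, add_zero, posS_apply, hfq, pow_succ, PiLp.inner_apply,
        RCLike.inner_apply, conj_trivial]
      push_cast
      simp only [Finset.mul_sum, Finset.sum_mul]
      exact Finset.sum_congr rfl fun x _ => by ring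

/-- The Fock span contains every power of a linear form times the Gaussian, and these are total in
`L²`. -/
theorem eq_zero_of_forall_inner_fockSpan {ψ : L2 ι}
    (h : ∀ f ∈ M.fockSpan, inner ℂ (schwToL2 ι f) ψ = 0) : ψ = 0 := by
  have h0 := eq_zero_of_forall_integral_pow_mul_expNegS_eq_zero M.vacExp_hasTemperateGrowth
    M.exists_le_vacExp.choose_spec.1 M.exists_le_vacExp.choose_spec.2 (Lp.memLp ψ) fun w m => by
      obtain ⟨f, hf, hfq⟩ := M.exists_mem_fockSpan_pow w m
      rw [← h f hf, L2.inner_def]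
      refine integral_congr_ae ?_
      filter_upwards [f.coeFn_toLp 2 volume] with q hq
      have hq' : schwToL2 ι f q = f q := hq
      rw [hq', hfq, RCLike.inner_apply, map_mul, Complex.conj_ofReal, vac, expNegS_apply,
        Complex.conj_ofReal, mul_comm]
  exact (Lp.eq_zero_iff_ae_eq_zero).2 h0

/-- The Hilbert basis of normalized Fock vectors. -/
theorem exists_hilbertBasis : ∃ b : HilbertBasis (Multiset ι) ℂ (L2 ι),
    ∀ n, b n = schwToL2 ι (M.fockUnit n) := by
  refine ⟨HilbertBasis.mkOfOrthogonalEqBot M.orthonormal_fockUnit ?_, fun n =>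
    congrFun (HilbertBasis.coe_mkOfOrthogonalEqBot _ _) n⟩
  rw [Submodule.eq_bot_iff]
  intro ψ hψ
  refine M.eq_zero_of_forall_inner_fockSpan fun f hf => ?_
  rw [Submodule.mem_orthogonal] at hψ
  refine hψ _ ?_
  have : M.fockSpan ≤ (Submodule.span ℂ
      (Set.range fun n => schwToL2 ι (M.fockUnit n))).comap (schwToL2 ι) := by
    refine Submodule.span_le.2 ?_
    rintro _ ⟨n, rfl⟩
    have e : M.fock n = (‖schwToL2 ι (M.fock n)‖ : ℂ) • M.fockUnit n := by
      rw [fockUnit, smul_smul, ← Complex.ofReal_mul,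
        mul_inv_cancel₀ (norm_ne_zero_iff.2 (M.fock_ne_zero n)), Complex.ofReal_one, one_smul]
    rw [SetLike.mem_coe, Submodule.mem_comap, e, map_smul]
    exact Submodule.smul_mem _ _ (Submodule.subset_span ⟨n, rfl⟩)
  exact this hf

theorem exists_isUnitaryGroupOf : ∃ U, IsUnitaryGroupOf (closedOp M.ham) U := by
  obtain ⟨b, hb⟩ := M.exists_hilbertBasis
  refine M.formalAdj_ham.exists_isUnitaryGroupOf b M.fockUnit hb M.energy fun n => ?_
  rw [fockUnit, map_smul, ham_fock, smul_comm]

theorem dense_fockSpan : Dense (schwToL2 ι '' M.fockSpan) := by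
  have h : (M.fockSpan.map (schwToL2 ι)).topologicalClosure = ⊤ := by
    rw [Submodule.topologicalClosure_eq_top_iff, Submodule.eq_bot_iff]
    intro ψ hψ
    refine M.eq_zero_of_forall_inner_fockSpan fun f hf => ?_
    exact (Submodule.mem_orthogonal _ _).1 hψ _ ⟨f, hf, rfl⟩
  exact Submodule.dense_iff_topologicalClosure_eq_top.2 h

end NormalModes

/-! ## Commutators of evolved operators -/

section Graphs

variable {H : Type*} [NormedAddCommGroup H] [InnerProductSpace ℂ H]

/-- In terms of graphs the product is a composition of relations, which spares the bookkeeping of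
dependent domains. -/
theorem mem_graph_pmapMul (A B : H →ₗ.[ℂ] H) (ψ φ : H) :
    (ψ, φ) ∈ (pmapMul A B).graph ↔ ∃ χ, (ψ, χ) ∈ B.graph ∧ (χ, φ) ∈ A.graph := by
  constructor
  · intro h
    rw [LinearPMap.mem_graph_iff] at h
    obtain ⟨⟨_, η, hη, rfl⟩, h1, h2⟩ := h
    obtain rfl : (η : H) = ψ := h1
    obtain rfl : A ⟨B η, hη⟩ = φ := h2
    exact ⟨B η, B.mem_graph η, A.mem_graph ⟨B η, hη⟩⟩
  · rintro ⟨χ, h1, h2⟩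
    rw [LinearPMap.mem_graph_iff] at h1 h2
    obtain ⟨η, rfl, rfl⟩ := h1
    obtain ⟨θ, h3, rfl⟩ := h2
    replace h3 : (θ : H) = B η := h3
    have hη : B η ∈ A.domain := h3 ▸ θ.2
    rw [LinearPMap.mem_graph_iff]
    refine ⟨⟨η, η, hη, rfl⟩, rfl, ?_⟩
    exact congrArg A (Subtype.ext h3.symm)

theorem mem_graph_pmapComm (A B : H →ₗ.[ℂ] H) (ψ φ : H) :
    (ψ, φ) ∈ (pmapComm A B).graph ↔ ∃ a b, (ψ, a) ∈ (pmapMul A B).graph ∧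
      (ψ, b) ∈ (pmapMul B A).graph ∧ φ = a - b := by
  constructor
  · intro h
    rw [LinearPMap.mem_graph_iff] at h
    obtain ⟨η, h1, h2⟩ := h
    obtain rfl : (η : H) = ψ := h1
    exact ⟨_, _, (pmapMul A B).mem_graph ⟨η, η.2.1⟩, (pmapMul B A).mem_graph ⟨η, η.2.2⟩, h2.symm⟩
  · rintro ⟨a, b, ha, hb, rfl⟩
    rw [LinearPMap.mem_graph_iff] at ha hb ⊢
    obtain ⟨η, rfl, rfl⟩ := ha
    obtain ⟨θ, h3, rfl⟩ := hb
    replace h3 : (θ : H) = η := h3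
    refine ⟨⟨η, η.2, h3 ▸ θ.2⟩, rfl, ?_⟩
    refine congrArg (pmapMul A B η - ·) ?_
    exact congrArg (pmapMul B A) (Subtype.ext h3.symm)

theorem mem_graph_toPMap_top (L : H →ₗ[ℂ] H) (ψ φ : H) :
    (ψ, φ) ∈ (L.toPMap ⊤).graph ↔ φ = L ψ := by
  rw [LinearPMap.mem_graph_iff]
  constructor
  · rintro ⟨η, h1, h2⟩
    obtain rfl : (η : H) = ψ := h1
    exact h2.symm
  · rintro rfl
    exact ⟨⟨ψ, trivial⟩, rfl, rfl⟩

theorem isUnitaryGroupOf_expGroup {T : H →ₗ.[ℂ] H} (h : ∃ U, IsUnitaryGroupOf T U) :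
    IsUnitaryGroupOf T (expGroup T) := by
  rw [expGroup, dif_pos h]
  exact h.choose_spec

theorem IsUnitaryGroupOf.apply_neg_apply {T : H →ₗ.[ℂ] H} {U : ℝ → H ≃ₗᵢ[ℂ] H}
    (hU : IsUnitaryGroupOf T U) (t : ℝ) (ψ : H) : U t (U (-t) ψ) = ψ := by
  have h0 : U 0 = 1 := by
    have := hU.map_add 0 0
    rw [add_zero] at this
    exact mul_eq_left.1 this.symm
  have h1 := hU.map_add t (-t)
  rw [add_neg_cancel, h0] at h1
  exact (congrArg (fun V : H ≃ₗᵢ[ℂ] H => V ψ) h1).symm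

theorem mem_graph_heisenberg {T : H →ₗ.[ℂ] H} (hU : IsUnitaryGroupOf T (expGroup T)) (t : ℝ)
    (A : H →ₗ.[ℂ] H) (ψ φ : H) :
    (ψ, φ) ∈ (heisenberg T t A).graph ↔ (expGroup T t ψ, expGroup T t φ) ∈ A.graph := by
  simp only [heisenberg, mem_graph_pmapMul, mem_graph_toPMap_top]
  constructor
  · rintro ⟨χ, ⟨_, rfl, h⟩, rfl⟩
    have : expGroup T t (expGroup T (-t) χ) = χ := hU.apply_neg_apply t χ
    change (_, expGroup T t (expGroup T (-t) χ)) ∈ _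
    rw [this]
    exact h
  · intro h
    refine ⟨expGroup T t φ, ⟨_, rfl, h⟩, ?_⟩
    have := hU.apply_neg_apply (-t) φ
    rw [neg_neg] at this
    exact this.symm

theorem opENorm_le {T : H →ₗ.[ℂ] H} (hd : Dense (T.domain : Set H)) {c : ℂ}
    (h : ∀ ψ φ, (ψ, φ) ∈ T.graph → φ = c • ψ) : opENorm T ≤ ‖c‖ₑ := by
  rw [opENorm, if_pos hd]
  refine iSup₂_le fun ψ hψ => ?_
  rw [h _ _ (T.mem_graph ψ), enorm_smul]
  refine (mul_le_mul_right (?_ : ‖(ψ : H)‖ₑ ≤ 1) _).trans (mul_one _).le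
  rw [← ofReal_norm]
  exact ENNReal.ofReal_le_one.2 hψ

end Graphs

/-! ### Heisenberg evolution of positions and momenta -/

namespace NormalModes

variable {ι : Type*} [Fintype ι] [DecidableEq ι] (M : NormalModes ι)

/-- The norm of the commutator of an evolved operator with another one, if the evolved operator is
given on the Fock vectors by an operator `At` whose commutator with `B` is a constant. -/
theorem opENorm_pmapComm_heisenberg_le {T : L2 ι →ₗ.[ℂ] L2 ι}
    (hU : IsUnitaryGroupOf T (expGroup T)) {t : ℝ} {A B At : Module.End ℂ (Schw ι)}
    (hA : FormalAdj A A) (hB : FormalAdj B B)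
    (hAt : ∀ f ∈ M.fockSpan, ∃ g, expGroup T t (schwToL2 ι f) = schwToL2 ι g ∧
      expGroup T t (schwToL2 ι (At f)) = schwToL2 ι (A g))
    (hBW : ∀ f ∈ M.fockSpan, B f ∈ M.fockSpan) {c : ℂ} (hc : commS At B = c • 1) :
    opENorm (pmapComm (heisenberg T t (closedOp A)) (closedOp B)) ≤ ‖c‖ₑ := by
  have hheis : ∀ f ∈ M.fockSpan,
      (schwToL2 ι f, schwToL2 ι (At f)) ∈ (heisenberg T t (closedOp A)).graph := fun f hf => by
    obtain ⟨g, h1, h2⟩ := hAt f hf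
    rw [mem_graph_heisenberg hU, h1, h2]
    exact mem_graph_closedOp A g
  have hsymm : ∀ f ∈ M.fockSpan, ∀ ψ φ, (ψ, φ) ∈ (heisenberg T t (closedOp A)).graph →
      inner ℂ (schwToL2 ι f) φ = inner ℂ (schwToL2 ι (At f)) ψ := fun f hf ψ φ h => by
    obtain ⟨g, h1, h2⟩ := hAt f hf
    rw [mem_graph_heisenberg hU] at h
    rw [← (expGroup T t).inner_map_map (schwToL2 ι f), h1, hA.inner_of_mem_graph h, ← h2,
      LinearIsometryEquiv.inner_map_map]
  have hcf : ∀ f, schwToL2 ι (B (At f)) = schwToL2 ι (At (B f)) - c • schwToL2 ι f := fun f => by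
    have := LinearMap.congr_fun hc f
    rw [commS_apply, LinearMap.sub_apply, LinearMap.smul_apply, Module.End.one_apply,
      Module.End.mul_apply, Module.End.mul_apply] at this
    rw [← map_smul, ← this, map_sub, sub_sub_cancel]
  -- Moving both operators onto the test vector reverses their order and places the constant in the
  -- conjugate-linear slot, so the commutator acts as `-conj c`.
  have hn : ‖c‖ₑ = ‖-(starRingEnd ℂ) c‖ₑ := by
    rw [enorm_neg, ← ofReal_norm, ← ofReal_norm, RCLike.norm_conj]
  rw [hn]
  refine opENorm_le (M.dense_fockSpan.mono ?_) fun ψ φ h => ?_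
  · rintro _ ⟨f, hf, rfl⟩
    refine LinearPMap.mem_domain_of_mem_graph
      (y := schwToL2 ι (At (B f)) - schwToL2 ι (B (At f))) ?_
    rw [mem_graph_pmapComm]
    refine ⟨_, _, ?_, ?_, rfl⟩
    · rw [mem_graph_pmapMul]
      exact ⟨_, mem_graph_closedOp B f, hheis _ (hBW f hf)⟩
    · rw [mem_graph_pmapMul]
      exact ⟨_, hheis f hf, mem_graph_closedOp B _⟩
  -- A vector of the natural domain need not be a Schwartz function, so the value is found by
  -- pairing with the Fock span, which is dense.
  · rw [mem_graph_pmapComm] at h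
    obtain ⟨a, b, ha, hb, rfl⟩ := h
    rw [mem_graph_pmapMul] at ha hb
    obtain ⟨χ, h1, h2⟩ := ha
    obtain ⟨χ', h3, h4⟩ := hb
    rw [← sub_eq_zero]
    refine M.eq_zero_of_forall_inner_fockSpan fun f hf => ?_
    rw [inner_sub_right, inner_sub_right, hsymm f hf _ _ h2, hB.inner_of_mem_graph h1,
      hB.inner_of_mem_graph h4, hsymm _ (hBW f hf) _ _ h3, hcf, inner_sub_left, inner_smul_left,
      inner_smul_right]
    ring

/-- The phase `exp (-2 i ω_j t)`. -/
noncomputable def phase (j : ι) (t : ℝ) : ℂ := Complex.exp (-(Complex.I * (t * (2 * M.ω j : ℝ))))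

theorem phase_mul_phase_neg (j : ι) (t : ℝ) : M.phase j t * M.phase j (-t) = 1 := by
  rw [phase, phase, ← Complex.exp_add]
  push_cast
  ring_nf
  exact Complex.exp_zero

/-- For a Fock vector of energy `E`, its images under `a_j` and `a_j†` are (possibly zero) solutions
of the eigenvalue equation with `E - 2ω_j` and `E + 2ω_j`, so the group acts by explicit phases. The
relations then extend linearly, with the same `g` for all `j`. -/
theorem exists_evolved {U : ℝ → L2 ι ≃ₗᵢ[ℂ] L2 ι} (hU : IsUnitaryGroupOf (closedOp M.ham) U)
    (t : ℝ) {f : Schw ι} (hf : f ∈ M.fockSpan) : ∃ g, U t (schwToL2 ι f) = schwToL2 ι g ∧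
      ∀ j, U t (schwToL2 ι (M.ann j f)) = M.phase j (-t) • schwToL2 ι (M.ann j g) ∧
        U t (schwToL2 ι (M.cre j f)) = M.phase j t • schwToL2 ι (M.cre j g) := by
  have heig : ∀ (f : Schw ι) (E : ℝ), M.ham f = (E : ℂ) • f →
      U t (schwToL2 ι f) = Complex.exp (-(Complex.I * (t * E))) • schwToL2 ι f := fun f E h =>
    hU.apply_eigenvector (by rw [← map_smul, ← h]; exact mem_graph_closedOp _ f) t
  induction hf using Submodule.span_induction with
  | mem f hf =>
    obtain ⟨n, rfl⟩ := hf
    refine ⟨Complex.exp (-(Complex.I * (t * M.energy n))) • M.fock n, ?_, fun j => ⟨?_, ?_⟩⟩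
    · rw [heig _ _ (M.ham_fock n), map_smul]
    · rw [heig _ (M.energy n - 2 * M.ω j), map_smul, map_smul, smul_smul, phase, ← Complex.exp_add]
      · congr 2; push_cast; ring
      · rw [ham_ann, ham_fock, map_smul, ← sub_smul]; push_cast; rfl
    · rw [heig _ (M.energy n + 2 * M.ω j), map_smul, map_smul, smul_smul, phase, ← Complex.exp_add]
      · congr 2; push_cast; ring
      · rw [ham_cre, ham_fock, map_smul, ← add_smul]; push_cast; rfl
  | zero => exact ⟨0, by simp, fun j => by simp⟩
  | add f f' _ _ ih ih' =>
    obtain ⟨g, h1, h2⟩ := ih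
    obtain ⟨g', h1', h2'⟩ := ih'
    refine ⟨g + g', by simp only [map_add, h1, h1'], fun j => ?_⟩
    simp only [map_add, (h2 j).1, (h2' j).1, (h2 j).2, (h2' j).2, smul_add, and_self]
  | smul c f _ ih =>
    obtain ⟨g, h1, h2⟩ := ih
    refine ⟨c • g, by simp only [map_smul, h1], fun j => ?_⟩
    simp only [map_smul, (h2 j).1, (h2 j).2, smul_comm c, and_self]

/-- The operator `∑_j (u_j a_j + v_j a_j†)`. -/
noncomputable def modeOp (u v : ι → ℂ) : Module.End ℂ (Schw ι) :=
  ∑ j, (u j • M.ann j + v j • M.cre j)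

/-- This solves the Heisenberg equations: annihilation coefficients rotate by a phase and creation
coefficients by its inverse. -/
theorem modeOp_evolved {U : ℝ → L2 ι ≃ₗᵢ[ℂ] L2 ι} (hU : IsUnitaryGroupOf (closedOp M.ham) U)
    (t : ℝ) (u v : ι → ℂ) {f : Schw ι} (hf : f ∈ M.fockSpan) :
    ∃ g, U t (schwToL2 ι f) = schwToL2 ι g ∧
      U t (schwToL2 ι (M.modeOp (fun j => u j * M.phase j t) (fun j => v j * M.phase j (-t)) f)) =
        schwToL2 ι (M.modeOp u v g) := by
  obtain ⟨g, h1, h2⟩ := M.exists_evolved hU t hf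
  refine ⟨g, h1, ?_⟩
  simp only [modeOp, LinearMap.sum_apply, LinearMap.add_apply, LinearMap.smul_apply, map_sum,
    map_add, map_smul, (h2 _).1, (h2 _).2, smul_smul, mul_assoc, phase_mul_phase_neg, mul_one]
  refine Finset.sum_congr rfl fun j _ => ?_
  rw [mul_comm (M.phase j (-t)), phase_mul_phase_neg, mul_one]

theorem commS_modeOp_posS (u v : ι → ℂ) (y : ι) : commS (M.modeOp u v) (posS y) =
    (∑ j, (u j - v j) * ((M.O y j * M.s y : ℝ) : ℂ)) • 1 := by
  simp only [modeOp, ann, cre, posS_eq_linOp, map_sum, map_add, map_smul, LinearMap.sum_apply,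
    LinearMap.add_apply, LinearMap.smul_apply, commS_linOp_linOp, smul_smul, ← add_smul,
    ← Finset.sum_smul]
  congr 1
  refine Finset.sum_congr rfl fun j _ => ?_
  simp only [Pi.zero_apply, mul_zero, Pi.single_apply, mul_ite, mul_one, zero_sub,
    Finset.sum_neg_distrib, Finset.sum_ite_eq', Finset.mem_univ, if_true]
  linear_combination (-u j + v j) * ((M.O y j * M.s y : ℝ) : ℂ) * Complex.I_mul_I

theorem commS_modeOp_momS (u v : ι → ℂ) (y : ι) : commS (M.modeOp u v) (momS y) =
    (∑ j, Complex.I * (u j + v j) * ((M.ω j * M.O y j / M.s y : ℝ) : ℂ)) • 1 := by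
  simp only [modeOp, ann, cre, momS_eq_linOp, map_sum, map_add, map_smul, LinearMap.sum_apply,
    LinearMap.add_apply, LinearMap.smul_apply, commS_linOp_linOp, smul_smul, ← add_smul,
    ← Finset.sum_smul]
  congr 1
  refine Finset.sum_congr rfl fun j _ => ?_
  simp only [Pi.zero_apply, mul_zero, Pi.single_apply, mul_ite, mul_one, sub_zero,
    Finset.sum_ite_eq', Finset.mem_univ, if_true]
  ring

theorem posS_eq_modeOp (x : ι) : posS x =
    M.modeOp (fun j => ((M.s x * M.O x j / (2 * M.ω j) : ℝ) : ℂ))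
      (fun j => ((M.s x * M.O x j / (2 * M.ω j) : ℝ) : ℂ)) := by
  rw [M.posS_eq_sum]
  simp only [modeOp, smul_add]

theorem momS_eq_modeOp (x : ι) : momS x =
    M.modeOp (fun j => -Complex.I * (M.O x j / (2 * M.s x) : ℝ))
      (fun j => Complex.I * (M.O x j / (2 * M.s x) : ℝ)) := by
  rw [M.momS_eq_sum]
  simp only [modeOp, smul_add, smul_smul]
  simp only [mul_neg, mul_one, neg_mul, neg_neg]

theorem phase_eq (j : ι) (t : ℝ) : M.phase j t =
    (Real.cos (2 * t * M.ω j) : ℂ) - (Real.sin (2 * t * M.ω j) : ℂ) * Complex.I := by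
  rw [phase, show -(Complex.I * (t * (2 * M.ω j : ℝ))) = ((-(2 * t * M.ω j) : ℝ) : ℂ) * Complex.I by
    push_cast; ring, Complex.exp_mul_I, ← Complex.ofReal_cos, ← Complex.ofReal_sin, Real.cos_neg,
    Real.sin_neg]
  push_cast
  ring

theorem phase_neg_eq (j : ι) (t : ℝ) : M.phase j (-t) =
    (Real.cos (2 * t * M.ω j) : ℂ) + (Real.sin (2 * t * M.ω j) : ℂ) * Complex.I := by
  rw [phase_eq, mul_neg, neg_mul, Real.cos_neg, Real.sin_neg]
  push_cast
  ring

theorem opENorm_modeOp_posS_le {u v : ι → ℂ} (hA : FormalAdj (M.modeOp u v) (M.modeOp u v))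
    (t : ℝ) (y : ι) :
    opENorm (pmapComm (heisenberg (closedOp M.ham) t (closedOp (M.modeOp u v))) (posOp y)) ≤
      ‖∑ j, (u j * M.phase j t - v j * M.phase j (-t)) * ((M.O y j * M.s y : ℝ) : ℂ)‖ₑ := by
  have hU := isUnitaryGroupOf_expGroup M.exists_isUnitaryGroupOf
  exact M.opENorm_pmapComm_heisenberg_le hU hA (formalAdj_posS y)
    (fun f hf => M.modeOp_evolved hU t u v hf) (fun f hf => M.posS_mem y hf)
    (M.commS_modeOp_posS _ _ y)

theorem opENorm_modeOp_momS_le {u v : ι → ℂ} (hA : FormalAdj (M.modeOp u v) (M.modeOp u v))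
    (t : ℝ) (y : ι) :
    opENorm (pmapComm (heisenberg (closedOp M.ham) t (closedOp (M.modeOp u v))) (momOp y)) ≤
      ‖∑ j, Complex.I * (u j * M.phase j t + v j * M.phase j (-t)) *
        ((M.ω j * M.O y j / M.s y : ℝ) : ℂ)‖ₑ := by
  have hU := isUnitaryGroupOf_expGroup M.exists_isUnitaryGroupOf
  exact M.opENorm_pmapComm_heisenberg_le hU hA (formalAdj_momS y)
    (fun f hf => M.modeOp_evolved hU t u v hf) (fun f hf => M.momS_mem y hf)
    (M.commS_modeOp_momS _ _ y)

theorem enorm_I_mul_ofReal (a : ℝ) : ‖Complex.I * (a : ℂ)‖ₑ = ‖a‖ₑ := by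
  rw [← ofReal_norm, ← ofReal_norm, norm_mul, Complex.norm_I, one_mul,
    Complex.norm_real]

/-- A position has equal coefficients on `a_j` and `a_j†`, a momentum opposite ones. Commuting with
a position subtracts the two phases and commuting with a momentum adds them, which decides between
sine and cosine here and in the next three bounds. -/
theorem opENorm_pos_pos_le (t : ℝ) (x y : ι) :
    opENorm (pmapComm (heisenberg (closedOp M.ham) t (posOp x)) (posOp y)) ≤
      ‖M.s x * M.s y * ∑ j, M.O x j * ((M.ω j)⁻¹ * Real.sin (2 * t * M.ω j)) * M.O y j‖ₑ := by
  have hA := formalAdj_posS x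
  rw [posOp, M.posS_eq_modeOp x] at *
  refine (M.opENorm_modeOp_posS_le hA t y).trans (le_of_eq ?_)
  rw [← enorm_neg, ← enorm_I_mul_ofReal]
  congr 1
  push_cast
  rw [← Finset.sum_neg_distrib, Finset.mul_sum, Finset.mul_sum]
  refine Finset.sum_congr rfl fun j _ => ?_
  rw [phase_eq, phase_neg_eq]
  push_cast
  have := Complex.ofReal_ne_zero.2 (M.ω_pos j).ne'
  field_simp
  ring

theorem opENorm_pos_mom_le (t : ℝ) (x y : ι) :
    opENorm (pmapComm (heisenberg (closedOp M.ham) t (posOp x)) (momOp y)) ≤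
      ‖M.s x / M.s y * ∑ j, M.O x j * Real.cos (2 * t * M.ω j) * M.O y j‖ₑ := by
  have hA := formalAdj_posS x
  rw [posOp, M.posS_eq_modeOp x] at *
  refine (M.opENorm_modeOp_momS_le hA t y).trans (le_of_eq ?_)
  rw [← enorm_I_mul_ofReal]
  congr 1
  push_cast
  rw [Finset.mul_sum, Finset.mul_sum]
  refine Finset.sum_congr rfl fun j _ => ?_
  rw [phase_eq, phase_neg_eq]
  push_cast
  have := Complex.ofReal_ne_zero.2 (M.ω_pos j).ne'
  field_simp
  ring

theorem opENorm_mom_pos_le (t : ℝ) (x y : ι) :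
    opENorm (pmapComm (heisenberg (closedOp M.ham) t (momOp x)) (posOp y)) ≤
      ‖M.s y / M.s x * ∑ j, M.O x j * Real.cos (2 * t * M.ω j) * M.O y j‖ₑ := by
  have hA := formalAdj_momS x
  rw [momOp, M.momS_eq_modeOp x] at *
  refine (M.opENorm_modeOp_posS_le hA t y).trans (le_of_eq ?_)
  rw [← enorm_neg, ← enorm_I_mul_ofReal]
  congr 1
  push_cast
  rw [← Finset.sum_neg_distrib, Finset.mul_sum, Finset.mul_sum]
  refine Finset.sum_congr rfl fun j _ => ?_
  rw [phase_eq, phase_neg_eq]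
  push_cast
  have := Complex.ofReal_ne_zero.2 (M.s_pos x).ne'
  field_simp
  ring

theorem opENorm_mom_mom_le (t : ℝ) (x y : ι) :
    opENorm (pmapComm (heisenberg (closedOp M.ham) t (momOp x)) (momOp y)) ≤
      ‖(M.s x * M.s y)⁻¹ * ∑ j, M.O x j * (M.ω j * Real.sin (2 * t * M.ω j)) * M.O y j‖ₑ := by
  have hA := formalAdj_momS x
  rw [momOp, M.momS_eq_modeOp x] at *
  refine (M.opENorm_modeOp_momS_le hA t y).trans (le_of_eq ?_)
  rw [← enorm_neg, ← enorm_I_mul_ofReal]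
  congr 1
  push_cast
  rw [← Finset.sum_neg_distrib, Finset.mul_sum, Finset.mul_sum]
  refine Finset.sum_congr rfl fun j _ => ?_
  rw [phase_eq, phase_neg_eq]
  push_cast
  have := Complex.ofReal_ne_zero.2 (M.s_pos x).ne'
  have := Complex.ofReal_ne_zero.2 (M.s_pos y).ne'
  field_simp
  linear_combination (-2 * (M.ω j : ℂ) * M.O x j * M.O y j *
    Complex.sin (2 * t * M.ω j)) * Complex.I_sq

end NormalModes

/-! ## The Hamiltonian in normal modes -/

namespace NormalModes

variable {ι : Type*} [Fintype ι] [DecidableEq ι] (M : NormalModes ι)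

/-- Since `(A - iB)(A + iB) = A² + B² + i[A, B]` and `[A, B] = iω_j`, the zero-point term `ω_j`
exactly compensates the commutator. -/
theorem cre_mul_ann (j : ι) : M.cre j * M.ann j + (M.ω j : ℂ) • 1 =
    linOp (fun x => ((M.ω j * M.O x j / M.s x : ℝ) : ℂ)) 0 ^ 2 +
      linOp 0 (fun x => ((M.O x j * M.s x : ℝ) : ℂ)) ^ 2 := by
  set A : Module.End ℂ (Schw ι) := linOp (fun x => ((M.ω j * M.O x j / M.s x : ℝ) : ℂ)) 0 with hA
  set B : Module.End ℂ (Schw ι) := linOp 0 (fun x => ((M.O x j * M.s x : ℝ) : ℂ)) with hB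
  have h1 : M.ann j = A + Complex.I • B := by
    rw [hA, hB, smul_linOp, linOp_add, ann]
    congr 1 <;> ext x <;> simp
  have h2 : M.cre j = A - Complex.I • B := by
    rw [sub_eq_add_neg, ← neg_smul, hA, hB, smul_linOp, linOp_add, cre]
    congr 1 <;> ext x <;> simp
  have h3 : A * B - B * A = (Complex.I * M.ω j) • 1 := by
    rw [← commS_apply, hA, hB, commS_linOp_linOp]
    congr 2
    have h : ∀ x, ((M.ω j * M.O x j / M.s x : ℝ) : ℂ) * ((M.O x j * M.s x : ℝ) : ℂ) =
        ((M.ω j * (M.O x j * M.O x j) : ℝ) : ℂ) := fun x => by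
      have := (M.s_pos x).ne'
      norm_cast
      field_simp
    simp only [Pi.zero_apply, mul_zero, sub_zero, h]
    rw [← Complex.ofReal_sum, ← Finset.mul_sum, sum_col, if_pos rfl, mul_one]
  have h4 : A * B = B * A + (Complex.I * M.ω j) • 1 := sub_eq_iff_eq_add'.1 h3
  rw [h1, h2, sub_mul, mul_add, mul_add, mul_smul_comm, h4, smul_mul_assoc, smul_mul_smul_comm,
    smul_add, smul_smul, ← mul_assoc, Complex.I_mul_I, pow_two, pow_two, neg_one_mul, neg_smul,
    neg_smul, one_smul]
  abel

/-- Orthogonality of the rows of `O` makes the kinetic part diagonal; the potential part has the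
matrix `s⁻¹ O diag(ω²) Oᵀ s⁻¹`. -/
theorem ham_eq : M.ham = ∑ x, ((M.s x ^ 2 : ℝ) : ℂ) • momS x ^ 2 +
    ∑ x, ∑ y, ((∑ j, M.ω j ^ 2 * M.O x j * M.O y j / (M.s x * M.s y) : ℝ) : ℂ) •
      (posS x * posS y) := by
  simp only [ham, cre_mul_ann, Finset.sum_add_distrib]
  rw [add_comm]
  congr 1
  · have h : ∀ j, linOp 0 (fun x => ((M.O x j * M.s x : ℝ) : ℂ)) ^ 2 =
        ∑ x, ∑ y, (((M.O x j * M.O y j) * (M.s x * M.s y) : ℝ) : ℂ) • (momS x * momS y) := fun j => by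
      simp only [linOp, Pi.zero_apply, zero_smul, zero_add, pow_two, Finset.sum_mul_sum,
        smul_mul_smul_comm]
      refine Finset.sum_congr rfl fun x _ => Finset.sum_congr rfl fun y _ => ?_
      congr 1; push_cast; ring
    simp only [h]
    rw [Finset.sum_comm]
    refine Finset.sum_congr rfl fun x _ => ?_
    rw [Finset.sum_comm]
    simp only [← Finset.sum_smul, ← Complex.ofReal_sum, ← Finset.sum_mul, sum_row]
    simp only [ite_mul, one_mul, zero_mul, apply_ite Complex.ofReal, Complex.ofReal_zero, ite_smul,
      zero_smul, Finset.sum_ite_eq, Finset.mem_univ, if_true, pow_two]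
  · have h : ∀ j, linOp (fun x => ((M.ω j * M.O x j / M.s x : ℝ) : ℂ)) 0 ^ 2 =
        ∑ x, ∑ y, ((M.ω j ^ 2 * M.O x j * M.O y j / (M.s x * M.s y) : ℝ) : ℂ) •
          (posS x * posS y) := fun j => by
      simp only [linOp, Pi.zero_apply, zero_smul, add_zero, pow_two, Finset.sum_mul_sum,
        smul_mul_smul_comm]
      refine Finset.sum_congr rfl fun x _ => Finset.sum_congr rfl fun y _ => ?_
      congr 1; norm_cast; rw [div_mul_div_comm]; ring
    simp only [h]
    rw [Finset.sum_comm]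
    refine Finset.sum_congr rfl fun x _ => ?_
    rw [Finset.sum_comm]
    simp only [← Finset.sum_smul, ← Complex.ofReal_sum]

end NormalModes

/-! ### Spectral facts for real symmetric matrices -/

theorem matFun_apply {n : Type*} [Fintype n] [DecidableEq n] {A : Matrix n n ℝ}
    (hA : A.IsHermitian) (φ : ℝ → ℂ) (x y : n) : matFun hA φ x y =
      ∑ j, ((hA.eigenvectorUnitary : Matrix n n ℝ) x j : ℂ) * φ (hA.eigenvalues j) *
        ((hA.eigenvectorUnitary : Matrix n n ℝ) y j : ℂ) := by
  rw [matFun, Matrix.mul_apply]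
  simp [Matrix.mul_diagonal]

theorem Matrix.IsHermitian.sum_eigenvalues_mul {n : Type*} [Fintype n] [DecidableEq n]
    {A : Matrix n n ℝ} (hA : A.IsHermitian) (x y : n) :
    ∑ j, hA.eigenvalues j * (hA.eigenvectorUnitary : Matrix n n ℝ) x j *
      (hA.eigenvectorUnitary : Matrix n n ℝ) y j = A x y := by
  conv_rhs => rw [hA.spectral_theorem, Unitary.conjStarAlgAut_apply, Matrix.mul_apply]
  refine Finset.sum_congr rfl fun j _ => ?_
  rw [Matrix.mul_diagonal, Matrix.star_apply, star_trivial, Function.comp_apply,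
    RCLike.ofReal_real_eq_id, id_eq, mul_comm (hA.eigenvalues j)]

/-- Gershgorin's circle theorem. -/
theorem Matrix.IsHermitian.abs_eigenvalues_le {n : Type*} [Fintype n] [DecidableEq n]
    {A : Matrix n n ℝ} (hA : A.IsHermitian) {K : ℝ} (hK : ∀ x, ∑ y, |A x y| ≤ K) (j : n) :
    |hA.eigenvalues j| ≤ K := by
  have h1 : Module.End.HasEigenvalue (Matrix.toLin' A) (hA.eigenvalues j) := by
    rw [Module.End.hasEigenvalue_iff_mem_spectrum, Matrix.spectrum_toLin']
    exact hA.eigenvalues_mem_spectrum_real j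
  obtain ⟨k, hk⟩ := eigenvalue_mem_ball h1
  rw [Metric.mem_closedBall, Real.dist_eq] at hk
  refine le_trans ?_ (hK k)
  rw [← Finset.add_sum_erase _ _ (Finset.mem_univ k)]
  have h2 := abs_sub_abs_le_abs_sub (hA.eigenvalues j) (A k k)
  simp only [Real.norm_eq_abs] at hk
  linarith

/-! ## The oscillator system -/

/-- Neighbours lie in a cube of side 3. The bound is crude, but it does not depend on `L`. -/
theorem card_dist1_eq_one_le {d L : ℕ} (x : box d L) :
    (Finset.univ.filter fun y : box d L => dist1 (x : Fin d → ℤ) y = 1).card ≤ 3 ^ d := by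
  classical
  have h : (Finset.univ.filter fun y : box d L => dist1 (x : Fin d → ℤ) y = 1).card ≤
      (Finset.Icc (fun i => (x : Fin d → ℤ) i - 1) fun i => (x : Fin d → ℤ) i + 1).card := by
    refine Finset.card_le_card_of_injOn (fun y => (y : Fin d → ℤ)) (fun y hy => ?_)
      Subtype.val_injective.injOn
    have hy : dist1 (x : Fin d → ℤ) y = 1 := by simpa using hy
    have h1 : ∀ i, |(x : Fin d → ℤ) i - (y : Fin d → ℤ) i| ≤ 1 := fun i => by
      rw [← hy]
      exact Finset.single_le_sum (f := fun i => |(x : Fin d → ℤ) i - (y : Fin d → ℤ) i|)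
        (fun i _ => abs_nonneg _) (Finset.mem_univ i)
    rw [Finset.mem_coe, Finset.mem_Icc]
    exact ⟨fun i => by have := abs_le.1 (h1 i); dsimp only; omega,
      fun i => by have := abs_le.1 (h1 i); dsimp only; omega⟩
  refine h.trans (le_of_eq ?_)
  rw [Pi.card_Icc]
  simp only [Int.card_Icc]
  rw [Finset.prod_congr rfl fun i _ => show ((x : Fin d → ℤ) i + 1 + 1 -
    ((x : Fin d → ℤ) i - 1)).toNat = 3 by omega]
  simp

namespace OscParams

variable {d : ℕ} (p : OscParams d)

/-- The coupling of two sites, which is zero unless they are neighbours. -/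
noncomputable def coup (L : ℕ) (x y : box d L) : ℝ :=
  if dist1 (x : Fin d → ℤ) y = 1 then p.lam s((x : Fin d → ℤ), y) else 0

theorem dist1_comm (x y : Fin d → ℤ) : dist1 x y = dist1 y x := by
  simp [dist1, abs_sub_comm]

theorem coup_comm (L : ℕ) (x y : box d L) : p.coup L x y = p.coup L y x := by
  rw [coup, coup, dist1_comm, Sym2.eq_swap]

theorem h0_apply (L : ℕ) (x y : box d L) : p.h0 L x y =
    (if x = y then p.k x / 2 + ∑ u, p.coup L x u else 0) - p.coup L x y := by
  by_cases hxy : x = y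
  · subst hxy
    have h1 : p.coup L x x = 0 := by simp [coup, dist1]
    rw [h1, h0, if_pos rfl, if_pos rfl, sub_zero]
    simp only [coup, dist1_comm (x : Fin d → ℤ)]
  · rw [h0, if_neg hxy, if_neg hxy, coup]
    split_ifs <;> simp

/-- Positions commute, so each square expands. The factor `1/2` for ordered pairs merges the two
square terms by symmetry into the diagonal of `h_{0,L}` and leaves `-λ` on the cross terms. -/
theorem hamS_eq (L : ℕ) : p.hamS L = ∑ x : box d L, ((1 / (2 * p.m x) : ℝ) : ℂ) • momS x ^ 2 +
    ∑ x, ∑ y, ((p.h0 L x y : ℝ) : ℂ) • (posS x * posS y) := by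
  have h1 : ∀ x y : box d L, (if dist1 (x : Fin d → ℤ) y = 1 then
        ((p.lam s((x : Fin d → ℤ), y) : ℝ) : ℂ) • (posS x - posS y) ^ 2
      else 0 : Module.End ℂ (Schw (box d L))) =
      (p.coup L x y : ℂ) • posS x ^ 2 + (p.coup L x y : ℂ) • posS y ^ 2 -
        (2 * p.coup L x y : ℂ) • (posS x * posS y) := fun x y => by
    have hc : posS y * posS x = (posS x * posS y : Module.End ℂ (Schw (box d L))) := by
      have := commS_posS_posS y x
      rw [commS_apply] at this
      exact sub_eq_zero.1 this
    rw [coup]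
    split_ifs with h
    · rw [pow_two, sub_mul, mul_sub, mul_sub, hc, ← pow_two, ← pow_two]
      module
    · simp
  have h2 : ∑ x : box d L, ∑ y : box d L, (p.coup L x y : ℂ) • posS y ^ 2 =
      ∑ x : box d L, ∑ y : box d L, (p.coup L x y : ℂ) •
        (posS x ^ 2 : Module.End ℂ (Schw (box d L))) := by
    rw [Finset.sum_comm]
    simp only [p.coup_comm L]
  have h3 : ∀ x y : box d L, ((p.h0 L x y : ℝ) : ℂ) •
      (posS x * posS y : Module.End ℂ (Schw (box d L))) =
      (if x = y then ((p.k x / 2 + ∑ u, p.coup L x u : ℝ) : ℂ) • (posS x * posS y) else 0) -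
        (p.coup L x y : ℂ) • (posS x * posS y) := fun x y => by
    rw [h0_apply, Complex.ofReal_sub, sub_smul]
    split_ifs <;> simp
  rw [hamS]
  simp only [h1, h3, Finset.sum_sub_distrib, Finset.sum_add_distrib, h2, Finset.sum_ite_eq,
    Finset.mem_univ, if_true, Complex.ofReal_add, add_smul, Complex.ofReal_sum, Finset.sum_smul,
    ← pow_two, mul_smul, ← Finset.smul_sum]
  module

section Modes

variable {p} {mmin mmax kmax lammax : ℝ}

theorem Bounded.m_pos (hb : p.Bounded mmin mmax kmax lammax) (hm : 0 < mmin) (x : Fin d → ℤ) :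
    0 < p.m x := hm.trans_le (hb.m_mem x).1

theorem sqrtMu_pos (hm : ∀ x, 0 < p.m x) (x : Fin d → ℤ) : 0 < Real.sqrt (1 / (2 * p.m x)) :=
  Real.sqrt_pos.2 (by have := hm x; positivity)

theorem h_apply (L : ℕ) (x y : box d L) : p.h L x y =
    Real.sqrt (1 / (2 * p.m x)) * p.h0 L x y * Real.sqrt (1 / (2 * p.m y)) := by
  rw [h, sqrtMu, Matrix.mul_diagonal, Matrix.diagonal_mul]

theorem h_posDef (hm : ∀ x, 0 < p.m x) {L : ℕ} (h0 : (p.h0 L).PosDef) : (p.h L).PosDef := by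
  have h1 : (p.sqrtMu L).conjTranspose = p.sqrtMu L := by simp [sqrtMu]
  have h2 := h0.conjTranspose_mul_mul_same (B := p.sqrtMu L) (fun v w hvw => by
    ext x
    have := congrFun hvw x
    simp only [sqrtMu, Matrix.mulVec_diagonal] at this
    exact mul_left_cancel₀ (sqrtMu_pos hm x).ne' this)
  rwa [h1] at h2

/-- The normal modes of the oscillator system. -/
noncomputable def modes (hm : ∀ x, 0 < p.m x) {L : ℕ} (h0 : (p.h0 L).PosDef) :
    NormalModes (box d L) where
  O := (p.h_isHermitian L).eigenvectorUnitary
  s x := Real.sqrt (1 / (2 * p.m x))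
  ω j := Real.sqrt ((p.h_isHermitian L).eigenvalues j)
  s_pos x := sqrtMu_pos hm x
  ω_pos j := Real.sqrt_pos.2 ((h_posDef hm h0).eigenvalues_pos j)
  orth := by
    have := Unitary.coe_star_mul_self (p.h_isHermitian L).eigenvectorUnitary
    rwa [Matrix.star_eq_conjTranspose, Matrix.conjTranspose_eq_transpose_of_trivial] at this

/-- Removing the factors `s_x`, `s_y` from the spectral form of `h_L` returns `h_{0,L}`, so both
sides close the same operator on the Schwartz space. -/
theorem ham_eq_modes (hm : ∀ x, 0 < p.m x) {L : ℕ} (h0 : (p.h0 L).PosDef) :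
    p.ham L = closedOp (modes hm h0).ham := by
  rw [ham, hamS_eq, NormalModes.ham_eq]
  congr 2
  · refine Finset.sum_congr rfl fun x _ => ?_
    have := hm x
    simp only [modes]
    rw [Real.sq_sqrt (by positivity)]
  · refine Finset.sum_congr rfl fun x _ => Finset.sum_congr rfl fun y _ => ?_
    congr 2
    simp only [modes]
    have h1 := (sqrtMu_pos hm x).ne'
    have h2 := (sqrtMu_pos hm y).ne'
    rw [← Finset.sum_div, eq_div_iff (mul_ne_zero h1 h2)]
    simp only [Real.sq_sqrt ((h_posDef hm h0).eigenvalues_pos _).le,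
      (p.h_isHermitian L).sum_eigenvalues_mul, h_apply]
    ring

end Modes

end OscParams

/-! ### Bounds by eigenfunction correlators -/

namespace OscParams

variable {d : ℕ} {p : OscParams d} {mmin mmax kmax lammax : ℝ}

theorem le_correlator (α r : ℝ) (hr : 0 ≤ r) (L : ℕ) (x y : box d L) (u : ℝ → ℝ)
    (hu : ∀ s, |u s| ≤ 1) :
    ‖∑ j, ((p.h_isHermitian L).eigenvectorUnitary : Matrix (box d L) (box d L) ℝ) x j *
      ((p.h_isHermitian L).eigenvalues j ^ α * u ((p.h_isHermitian L).eigenvalues j)) *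
      ((p.h_isHermitian L).eigenvectorUnitary : Matrix (box d L) (box d L) ℝ) y j‖ₑ ^ r ≤
    p.correlator α r L x y := by
  have h : ∀ s, ‖((u s : ℝ) : ℂ)‖ ≤ 1 := fun s => by
    rw [Complex.norm_real]
    exact hu s
  refine le_trans (ENNReal.rpow_le_rpow (le_of_eq ?_) hr)
    (le_iSup₂ (f := fun (u : ℝ → ℂ) (_ : ∀ s, ‖u s‖ ≤ 1) =>
      ‖matFun (p.h_isHermitian L) (fun s => ((s ^ α : ℝ) : ℂ) * u s) x y‖ₑ ^ r) _ h)
  rw [matFun_apply, ← ofReal_norm, ← ofReal_norm, ← Complex.norm_real]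
  push_cast
  rfl

theorem enorm_mul_le_ofReal_mul {a b K : ℝ} (ha : |a| ≤ K) : ‖a * b‖ₑ ≤ ENNReal.ofReal K * ‖b‖ₑ := by
  rw [enorm_mul]
  gcongr
  rw [← ofReal_norm]
  exact ENNReal.ofReal_le_ofReal ha

theorem sqrtMu_le (hb : p.Bounded mmin mmax kmax lammax) (hm : 0 < mmin) (x : Fin d → ℤ) :
    Real.sqrt (1 / (2 * p.m x)) ≤ Real.sqrt (1 / (2 * mmin)) := by
  have := (hb.m_mem x).1
  gcongr

theorem le_sqrtMu (hb : p.Bounded mmin mmax kmax lammax) (hm : 0 < mmin) (x : Fin d → ℤ) :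
    Real.sqrt (1 / (2 * mmax)) ≤ Real.sqrt (1 / (2 * p.m x)) := by
  have h1 := hb.m_pos hm x
  have := (hb.m_mem x).2
  gcongr

/-- A bound on the spectrum of `h_L` that does not depend on `L`. -/
noncomputable def specBound (d : ℕ) (mmin kmax lammax : ℝ) : ℝ :=
  1 / (2 * mmin) * (|kmax| / 2 + 2 * (3 ^ d * |lammax|))

theorem coup_nonneg (hb : p.Bounded mmin mmax kmax lammax) (L : ℕ) (x y : box d L) :
    0 ≤ p.coup L x y := by
  rw [coup]
  split_ifs with h
  · exact (hb.lam_mem x y h).1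
  · exact le_rfl

theorem sum_coup_le (hb : p.Bounded mmin mmax kmax lammax) (L : ℕ) (x : box d L) :
    ∑ y, p.coup L x y ≤ 3 ^ d * |lammax| := by
  simp only [coup]
  rw [← Finset.sum_filter]
  refine (Finset.sum_le_card_nsmul _ _ |lammax| fun y hy => ?_).trans ?_
  · rw [Finset.mem_filter] at hy
    exact (hb.lam_mem x y hy.2).2.trans (le_abs_self _)
  · rw [nsmul_eq_mul]
    refine mul_le_mul_of_nonneg_right ?_ (abs_nonneg _)
    exact_mod_cast card_dist1_eq_one_le x

theorem sum_abs_h_le (hb : p.Bounded mmin mmax kmax lammax) (hm : 0 < mmin) (L : ℕ)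
    (x : box d L) : ∑ y, |p.h L x y| ≤ specBound d mmin kmax lammax := by
  have h1 : ∀ y, |p.h L x y| ≤ 1 / (2 * mmin) *
      ((if x = y then p.k x / 2 + ∑ u, p.coup L x u else 0) + p.coup L x y) := fun y => by
    rw [h_apply, abs_mul, abs_mul, abs_of_nonneg (Real.sqrt_nonneg _),
      abs_of_nonneg (Real.sqrt_nonneg _), mul_right_comm]
    have e1 : Real.sqrt (1 / (2 * p.m x)) * Real.sqrt (1 / (2 * p.m y)) ≤ 1 / (2 * mmin) := by
      rw [← Real.mul_self_sqrt (show 0 ≤ 1 / (2 * mmin) by positivity)]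
      exact mul_le_mul (sqrtMu_le hb hm x) (sqrtMu_le hb hm y) (Real.sqrt_nonneg _)
        (Real.sqrt_nonneg _)
    refine mul_le_mul e1 ?_ (abs_nonneg _) (by positivity)
    rw [h0_apply]
    refine (abs_sub _ _).trans ?_
    rw [abs_of_nonneg (coup_nonneg hb L x y), abs_of_nonneg]
    split_ifs
    · exact add_nonneg (by have := (hb.k_mem x).1; linarith)
        (Finset.sum_nonneg fun u _ => coup_nonneg hb L x u)
    · exact le_rfl
  refine (Finset.sum_le_sum fun y _ => h1 y).trans ?_
  rw [← Finset.mul_sum, Finset.sum_add_distrib, specBound]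
  refine mul_le_mul_of_nonneg_left ?_ (by positivity)
  simp only [Finset.sum_ite_eq, Finset.mem_univ, if_true]
  have h2 := sum_coup_le hb L x
  have h3 := (hb.k_mem x).2
  have h4 := le_abs_self kmax
  linarith

theorem commNorm_pos_pos_le (hb : p.Bounded mmin mmax kmax lammax) (hm : 0 < mmin) {L : ℕ}
    (h0 : (p.h0 L).PosDef) (x y : box d L) (t : ℝ) {r : ℝ} (hr : 0 ≤ r) :
    p.commNorm L t (posOp x) (posOp y) ^ r ≤
      ENNReal.ofReal ((1 / (2 * mmin)) ^ r) * p.correlator (-1 / 2) r L x y := by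
  have hm' := hb.m_pos hm
  have h1 := (modes hm' h0).opENorm_pos_pos_le t x y
  rw [← ham_eq_modes] at h1
  have h2 : |(modes hm' h0).s x * (modes hm' h0).s y| ≤ 1 / (2 * mmin) := by
    rw [abs_of_pos (mul_pos ((modes hm' h0).s_pos x) ((modes hm' h0).s_pos y)),
      ← Real.mul_self_sqrt (show 0 ≤ 1 / (2 * mmin) by positivity)]
    exact mul_le_mul (sqrtMu_le hb hm x) (sqrtMu_le hb hm y) (Real.sqrt_nonneg _)
      (Real.sqrt_nonneg _)
  have h3 := le_correlator (p := p) (-1 / 2) r hr L x y (fun s => Real.sin (2 * t * Real.sqrt s))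
    fun s => Real.abs_sin_le_one _
  -- Positivity of the eigenvalues identifies the real power `-1/2` with the inverse square root.
  have h4 : ∀ j, (p.h_isHermitian L).eigenvalues j ^ (-1 / 2 : ℝ) =
      (Real.sqrt ((p.h_isHermitian L).eigenvalues j))⁻¹ := fun j => by
    rw [neg_div, Real.rpow_neg ((h_posDef hm' h0).eigenvalues_pos j).le, Real.sqrt_eq_rpow]
  simp only [h4] at h3
  calc p.commNorm L t (posOp x) (posOp y) ^ r
      ≤ _ := ENNReal.rpow_le_rpow (h1.trans (enorm_mul_le_ofReal_mul h2)) hr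
    _ = _ := ENNReal.mul_rpow_of_nonneg _ _ hr
    _ ≤ _ := by
      rw [ENNReal.ofReal_rpow_of_nonneg (by positivity) hr]
      exact mul_le_mul_right h3 _

theorem sqrtMu_div_le (hb : p.Bounded mmin mmax kmax lammax) (hm : 0 < mmin)
    (x y : Fin d → ℤ) : |Real.sqrt (1 / (2 * p.m x)) / Real.sqrt (1 / (2 * p.m y))| ≤
      Real.sqrt (1 / (2 * mmin)) / Real.sqrt (1 / (2 * mmax)) := by
  have hM : 0 < mmax := (hb.m_pos hm x).trans_le (hb.m_mem x).2
  have h1 : 0 < Real.sqrt (1 / (2 * mmax)) := Real.sqrt_pos.2 (by positivity)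
  rw [abs_of_nonneg (by positivity)]
  exact div_le_div₀ (Real.sqrt_nonneg _) (sqrtMu_le hb hm x) h1 (le_sqrtMu hb hm y)

theorem enorm_cos_sum_le (t : ℝ) {L : ℕ} (hm : ∀ x, 0 < p.m x) (h0 : (p.h0 L).PosDef)
    (x y : box d L) :
    ‖∑ j, (modes hm h0).O x j * Real.cos (2 * t * (modes hm h0).ω j) * (modes hm h0).O y j‖ₑ ≤
      p.correlator 0 1 L x y := by
  have h3 := le_correlator (p := p) 0 1 zero_le_one L x y (fun s => Real.cos (2 * t * Real.sqrt s))
    fun s => Real.abs_cos_le_one _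
  simp only [Real.rpow_zero, one_mul, ENNReal.rpow_one] at h3
  exact h3

theorem commNorm_mom_pos_le (hb : p.Bounded mmin mmax kmax lammax) (hm : 0 < mmin) {L : ℕ}
    (h0 : (p.h0 L).PosDef) (x y : box d L) (t : ℝ) :
    p.commNorm L t (momOp x) (posOp y) ≤
      ENNReal.ofReal (Real.sqrt (1 / (2 * mmin)) / Real.sqrt (1 / (2 * mmax))) *
        p.correlator 0 1 L x y := by
  have hm' := hb.m_pos hm
  have h1 := (modes hm' h0).opENorm_mom_pos_le t x y
  rw [← ham_eq_modes] at h1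
  exact (h1.trans (enorm_mul_le_ofReal_mul (sqrtMu_div_le hb hm y x))).trans
    (mul_le_mul_right (enorm_cos_sum_le t hm' h0 x y) _)

theorem commNorm_pos_mom_le (hb : p.Bounded mmin mmax kmax lammax) (hm : 0 < mmin) {L : ℕ}
    (h0 : (p.h0 L).PosDef) (x y : box d L) (t : ℝ) :
    p.commNorm L t (posOp x) (momOp y) ≤
      ENNReal.ofReal (Real.sqrt (1 / (2 * mmin)) / Real.sqrt (1 / (2 * mmax))) *
        p.correlator 0 1 L x y := by
  have hm' := hb.m_pos hm
  have h1 := (modes hm' h0).opENorm_pos_mom_le t x y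
  rw [← ham_eq_modes] at h1
  exact (h1.trans (enorm_mul_le_ofReal_mul (sqrtMu_div_le hb hm x y))).trans
    (mul_le_mul_right (enorm_cos_sum_le t hm' h0 x y) _)

/-- The growing factor `√s` is normalized by `√S`, where `S` bounds the spectrum uniformly in `L`.
Cutting off above `S` makes the function admissible without changing its values on eigenvalues. -/
theorem enorm_sin_sum_le (hb : p.Bounded mmin mmax kmax lammax) (hm : 0 < mmin) (t : ℝ) {L : ℕ}
    (hm' : ∀ x, 0 < p.m x) (h0 : (p.h0 L).PosDef) (x y : box d L) :
    ‖∑ j, (modes hm' h0).O x j * ((modes hm' h0).ω j * Real.sin (2 * t * (modes hm' h0).ω j)) *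
      (modes hm' h0).O y j‖ₑ ≤
      ENNReal.ofReal (Real.sqrt (specBound d mmin kmax lammax)) * p.correlator 0 1 L x y := by
  set S := specBound d mmin kmax lammax with hS
  have hev : ∀ j, (p.h_isHermitian L).eigenvalues j ≤ S := fun j =>
    (le_abs_self _).trans ((p.h_isHermitian L).abs_eigenvalues_le (sum_abs_h_le hb hm L) j)
  have hpos : ∀ j, 0 < (p.h_isHermitian L).eigenvalues j := (h_posDef hm' h0).eigenvalues_pos
  -- The eigenvalues are indexed by sites, so `x` itself provides a positive one.
  have hS0 : 0 < S := (hpos x).trans_le (hev x)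
  let u : ℝ → ℝ := fun s => if s ≤ S then
    Real.sqrt s / Real.sqrt S * Real.sin (2 * t * Real.sqrt s) else 0
  have hu : ∀ s, |u s| ≤ 1 := fun s => by
    simp only [u]
    split_ifs with hs
    · rw [abs_mul, abs_of_nonneg (by positivity)]
      refine mul_le_one₀ ?_ (abs_nonneg _) (Real.abs_sin_le_one _)
      exact div_le_one_of_le₀ (Real.sqrt_le_sqrt hs) (Real.sqrt_nonneg _)
    · simp
  have h3 := le_correlator (p := p) 0 1 zero_le_one L x y u hu
  simp only [Real.rpow_zero, one_mul, ENNReal.rpow_one] at h3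
  refine le_trans (le_of_eq ?_) ((enorm_mul_le_ofReal_mul
    (abs_of_nonneg (Real.sqrt_nonneg S)).le).trans (mul_le_mul_right h3 _))
  congr 1
  rw [Finset.mul_sum]
  refine Finset.sum_congr rfl fun j _ => ?_
  have hsq : Real.sqrt S ≠ 0 := (Real.sqrt_pos.2 hS0).ne'
  simp only [u, if_pos (hev j), modes]
  field_simp

theorem commNorm_mom_mom_le (hb : p.Bounded mmin mmax kmax lammax) (hm : 0 < mmin) {L : ℕ}
    (h0 : (p.h0 L).PosDef) (x y : box d L) (t : ℝ) :
    p.commNorm L t (momOp x) (momOp y) ≤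
      ENNReal.ofReal (2 * mmax * Real.sqrt (specBound d mmin kmax lammax)) *
        p.correlator 0 1 L x y := by
  have hm' := hb.m_pos hm
  have hM : 0 < mmax := (hm' x).trans_le (hb.m_mem x).2
  have h1 := (modes hm' h0).opENorm_mom_mom_le t x y
  rw [← ham_eq_modes] at h1
  have hs : 0 < Real.sqrt (1 / (2 * mmax)) := Real.sqrt_pos.2 (by positivity)
  have h2 : |((modes hm' h0).s x * (modes hm' h0).s y)⁻¹| ≤ 2 * mmax := by
    rw [abs_of_pos (inv_pos.2 (mul_pos ((modes hm' h0).s_pos x) ((modes hm' h0).s_pos y)))]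
    -- The constant is the reciprocal of the least possible value of `s_x s_y`.
    have e : (2 * mmax) = (Real.sqrt (1 / (2 * mmax)) * Real.sqrt (1 / (2 * mmax)))⁻¹ := by
      rw [Real.mul_self_sqrt (by positivity), one_div, inv_inv]
    rw [e]
    refine inv_anti₀ (mul_pos hs hs) ?_
    exact mul_le_mul (le_sqrtMu hb hm x) (le_sqrtMu hb hm y) hs.le (Real.sqrt_nonneg _)
  refine (h1.trans (enorm_mul_le_ofReal_mul h2)).trans ?_
  rw [ENNReal.ofReal_mul (p := 2 * mmax) (by positivity), mul_assoc]
  exact mul_le_mul_right (enorm_sin_sum_le hb hm t hm' h0 x y) _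

end OscParams

/-- Monotonicity of the lower integral and extraction of a finite constant need no measurability, so
the uncountable suprema over `u` and `t` cause no difficulty. The decay rate is unchanged. -/
theorem ExpDecayInMean.of_le_const_mul {Ω : Type*} [MeasurableSpace Ω] {P : Measure Ω} {d : ℕ}
    {F G : Ω → (L : ℕ) → box d L → box d L → ℝ≥0∞} {K : ℝ} (hK : 0 ≤ K)
    (hF : ExpDecayInMean P F)
    (h : ∀ᵐ ω ∂P, ∀ L : ℕ, 1 ≤ L → ∀ x y, G ω L x y ≤ ENNReal.ofReal K * F ω L x y) :
    ExpDecayInMean P G := by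
  obtain ⟨C, μ, hμ, hC⟩ := hF
  refine ⟨K * C, μ, hμ, fun L hL x y => ?_⟩
  calc ∫⁻ ω, G ω L x y ∂P ≤ ∫⁻ ω, ENNReal.ofReal K * F ω L x y ∂P :=
        lintegral_mono_ae (h.mono fun ω hω => hω L hL x y)
    _ = ENNReal.ofReal K * ∫⁻ ω, F ω L x y ∂P := lintegral_const_mul' _ _ ENNReal.ofReal_ne_top
    _ ≤ ENNReal.ofReal K * ENNReal.ofReal (C * Real.exp (-μ * dist1 (x : Fin d → ℤ) y)) := by
        gcongr
        exact hC L hL x y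
    _ = _ := by rw [← ENNReal.ofReal_mul hK, mul_assoc]

theorem theorem3p5 {Ω : Type*} [MeasurableSpace Ω] (P : Measure Ω) [IsProbabilityMeasure P]
    (d : ℕ) (hd : 1 ≤ d) (p : Ω → OscParams d)
    (hm : ∀ x, Measurable fun ω => (p ω).m x)
    (hk : ∀ x, Measurable fun ω => (p ω).k x)
    (hlam : ∀ e, Measurable fun ω => (p ω).lam e)
    (mmin mmax kmax lammax : ℝ) (hmmin : 0 < mmin)
    (hA1 : ∀ᵐ ω ∂P, (p ω).Bounded mmin mmax kmax lammax)
    (hA2 : ∀ᵐ ω ∂P, ∀ L : ℕ, 1 ≤ L → ((p ω).h0 L).PosDef) :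
    (∀ r : ℝ, 0 < r → r ≤ 1 →
      ExpDecayInMean P (fun ω L x y => (p ω).correlator (-1 / 2) r L x y) →
      ExpDecayInMean P (fun ω L x y =>
        ⨆ t : ℝ, (p ω).commNorm L t (posOp x) (posOp y) ^ r)) ∧
    (ExpDecayInMean P (fun ω L x y => (p ω).correlator 0 1 L x y) →
      ExpDecayInMean P (fun ω L x y =>
        ⨆ t : ℝ, max ((p ω).commNorm L t (momOp x) (posOp y))
          (max ((p ω).commNorm L t (posOp x) (momOp y))
            ((p ω).commNorm L t (momOp x) (momOp y))))) := by
  refine ⟨fun r hr _ h => ?_, fun h => ?_⟩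
  · refine h.of_le_const_mul (K := (1 / (2 * mmin)) ^ r) (by positivity) ?_
    filter_upwards [hA1, hA2] with ω hb h0 L hL x y
    exact iSup_le fun t => OscParams.commNorm_pos_pos_le hb hmmin (h0 L hL) x y t hr.le
  -- One deterministic constant serves all three commutators: the mass ratio for the mixed ones, the
  -- spectral bound for the momentum pair.
  · refine h.of_le_const_mul
      (K := max (Real.sqrt (1 / (2 * mmin)) / Real.sqrt (1 / (2 * mmax)))
        (2 * mmax * Real.sqrt (OscParams.specBound d mmin kmax lammax)))
      (le_max_of_le_left (by positivity)) ?_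
    filter_upwards [hA1, hA2] with ω hb h0 L hL x y
    refine iSup_le fun t => max_le ?_ (max_le ?_ ?_)
    · refine (OscParams.commNorm_mom_pos_le hb hmmin (h0 L hL) x y t).trans ?_
      gcongr
      exact le_max_left _ _
    · refine (OscParams.commNorm_pos_mom_le hb hmmin (h0 L hL) x y t).trans ?_
      gcongr
      exact le_max_left _ _
    · refine (OscParams.commNorm_mom_mom_le hb hmmin (h0 L hL) x y t).trans ?_
      gcongr
      exact le_max_right _ _
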